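/- For complex numbers $y,q$ with $0<|q|<1$ let $(y;q)_\infty=\prod_{i\ge 0}(1-yq^i)$, and for $k\in\mathbb Z$ let $(y;q)_k=(y;q)_\infty/(yq^k;q)_\infty$; that is, $(y;q)_k=\prod_{i=0}^{k-1}(1-yq^i)$ for $k\ge 0$ and $(y;q)_{-k}=1/\prod_{i=1}^{k}(1-yq^{-i})$ for $k\ge 1$. Write $(y_1,\dots,y_r;q)_k=(y_1;q)_k\cdots(y_r;q)_k$, also for $k=\infty$, and $${}_r\psi_s\left[\begin{matrix}a_1,\dots,a_r\\ b_1,\dots,b_s\end{matrix};q,z\right]=\sum_{k=-\infty}^{\infty}\frac{(a_1,\dots,a_r;q)_k}{(b_1,\dots,b_s;q)_k}\left\{(-1)^kq^{\binom k2}\right\}^{s-r}z^k .$$ **Theorem 1.** Let $q,a,b,c,x$ be complex numbers with $0<|q|<1$, with $a,b,c,x$ non-zero and $$\max\{|aq/bcx|,\ |aqx/bc|\}<1,$$ and such that no zero factor occurs in a denominator of the formula below; that is, $a,b,c,bx,cx\notin\{q^{n}:n\ge 1\}$, $\ aq/b,\,aq/c,\,qx^2,\,aqx^2\notin\{q^{-n}:n\ge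 0\}$ and $ax\notin\{q^n:n\in\mathbb Z\}$. Then, for any choice of the square roots $(ax)^{1/2},(aq)^{1/2},a^{1/2}$, both bilateral series below converge absolutely, and $$\begin{aligned} &{}_2\psi_2\left[\begin{matrix}b,c\\ aq/b,aq/c\end{matrix};q,\frac{aqx}{bc}\right] =\frac{(q/a,\,aq/bc,\,q/bx,\,q/cx,\,qx,\,aqx^2;q)_\infty}{(q/b,\,q/c,\,aq/bcx,\,q/ax,\,aqx,\,qx^2;q)_\infty}\\ &\quad\times{}_8\psi_8\left[\begin{matrix}q(ax)^{\frac12},-q(ax)^{\frac12},(aq)^{\frac12},-(aq)^{\frac12},a^{\frac12},-a^{\frac12},bx,cx\\ (ax)^{\frac12},-(ax)^{\frac12},x(aq)^{\frac12},-x(aq)^{\frac12},xqa^{\frac12},-xqa^{\frac12},aq/b,aq/c\end{matrix};q,\frac{aqx}{bc}\right]. \end{aligned}$$ -/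

import Mathlib

noncomputable section

/-- The infinite `q`-shifted factorial `(x; q)_∞ = ∏_{i ≥ 0} (1 - x q^i)`. -/
def qPochInf (x q : ℂ) : ℂ := ∏' i : ℕ, (1 - x * q ^ i)

/-- `(x₁, …, x_r; q)_∞ = (x₁; q)_∞ ⋯ (x_r; q)_∞`. -/
def qPochInfs (xs : List ℂ) (q : ℂ) : ℂ := (xs.map fun x => qPochInf x q).prod

/-- The `q`-shifted factorial `(x; q)_n` for an integer `n`:
`(x; q)_n = (1 - x)(1 - x q) ⋯ (1 - x q^(n-1))` for `n ≥ 0`, and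
`(x; q)_{-n} = 1 / ((1 - x q^(-1)) ⋯ (1 - x q^(-n)))` for `n ≥ 1`.
It equals `(x; q)_∞ / (x q^n; q)_∞` wherever that quotient makes sense; see
`qPoch_eq_div` below. Since `0⁻¹⁻¹ = 0`, a denominator entry `1 / (x; q)_{-n}` is always
the polynomial `(1 - x q^(-1)) ⋯ (1 - x q^(-n))`, also where it vanishes. -/
def qPoch (x q : ℂ) : ℤ → ℂ
  | Int.ofNat n => ∏ i ∈ Finset.range n, (1 - x * q ^ i)
  | Int.negSucc n => (∏ i ∈ Finset.range (n + 1), (1 - x / q ^ (i + 1)))⁻¹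

/-- `(x₁, …, x_r; q)_n = (x₁; q)_n ⋯ (x_r; q)_n`. -/
def qPochs (xs : List ℂ) (q : ℂ) (n : ℤ) : ℂ := (xs.map fun x => qPoch x q n).prod

/-- The `k`-th term, `k ∈ ℤ`, of the bilateral basic hypergeometric series `_rψ_s` with
numerator parameters `as` (of length `r`) and denominator parameters `bs` (of length `s`). -/
def psiTerm (as bs : List ℂ) (q z : ℂ) (k : ℤ) : ℂ :=
  qPochs as q k / qPochs bs q k
    * ((-1) ^ k * q ^ (k * (k - 1) / 2)) ^ ((bs.length : ℤ) - (as.length : ℤ)) * z ^ k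

/-- The bilateral basic hypergeometric series `_rψ_s[as; bs; q, z]`. -/
def psi (as bs : List ℂ) (q z : ℂ) : ℂ := ∑' k : ℤ, psiTerm as bs q z k

theorem qPochInf_split (x : ℂ) {q : ℂ} (hq : ‖q‖ < 1) (n : ℕ) :
    qPochInf x q = (∏ i ∈ Finset.range n, (1 - x * q ^ i)) * qPochInf (x * q ^ n) q := by
  have hm : Multipliable fun i : ℕ => (1 - x * q ^ (i + n)) := by
    have hs : Summable fun i : ℕ => ‖-(x * q ^ (i + n))‖ := by
      have h := (summable_geometric_of_norm_lt_one hq).norm.mul_left ‖x * q ^ n‖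
      refine h.congr fun i => ?_
      rw [norm_neg, ← norm_mul]
      congr 1
      ring
    simpa [sub_eq_add_neg] using multipliable_one_add_of_summable hs
  have h : (∏ i ∈ Finset.range n, (1 - x * q ^ i)) * ∏' i : ℕ, (1 - x * q ^ (i + n))
      = ∏' i : ℕ, (1 - x * q ^ i) :=
    Multipliable.prod_mul_tprod_nat_mul' (f := fun i : ℕ => 1 - x * q ^ i) hm
  have h' : ∀ i : ℕ, 1 - x * q ^ n * q ^ i = 1 - x * q ^ (i + n) := fun i => by ring
  simp only [qPochInf, h']
  exact h.symm

/-- `(x; q)_n = (x; q)_∞ / (x q^n; q)_∞` for every integer `n`. -/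
theorem qPoch_eq_div (x : ℂ) {q : ℂ} (hq0 : q ≠ 0) (hq : ‖q‖ < 1) (n : ℤ)
    (h : qPochInf (x * q ^ n) q ≠ 0) :
    qPoch x q n = qPochInf x q / qPochInf (x * q ^ n) q := by
  cases n with
  | ofNat n =>
    rw [eq_div_iff h, qPochInf_split x hq n]
    simp [qPoch]
  | negSucc n =>
    have h1 := qPochInf_split (x * q ^ (Int.negSucc n)) hq (n + 1)
    have h2 : x * q ^ (Int.negSucc n) * q ^ (n + 1) = x := by
      rw [zpow_negSucc, mul_assoc, inv_mul_cancel₀ (pow_ne_zero _ hq0), mul_one]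
    have h3 : ∏ i ∈ Finset.range (n + 1), (1 - x * q ^ (Int.negSucc n) * q ^ i)
        = ∏ i ∈ Finset.range (n + 1), (1 - x / q ^ (i + 1)) := by
      rw [← Finset.prod_range_reflect]
      refine Finset.prod_congr rfl fun i hi => ?_
      have hi' : i ≤ n := Nat.lt_succ_iff.mp (Finset.mem_range.mp hi)
      have e : q ^ (n + 1) = q ^ (n + 1 - 1 - i) * q ^ (i + 1) := by
        rw [← pow_add]
        congr 1
        omega
      rw [zpow_negSucc, e]
      field_simp
    rw [h2, h3] at h1
    have h4 : qPochInf x q ≠ 0 := fun h0 => h (by rw [h1, h0, mul_zero])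
    rw [h1]
    simp only [qPoch]
    rw [div_mul_cancel_right₀ h4]

end

/-! Put `β = 1/b`, `γ = 1/c` and multiply through by infinite products, so that both sides become
analytic in `β` wherever the majorants converge (`PsiTransformation`). Ismail's argument then
applies: the identity is checked on a sequence of `β` tending to `0` and extended by the identity
theorem.

For `β = 1/a`, that is `b = a`, the denominator parameter `aq/b` equals `q`, the terms with `k < 0`
vanish, and the claim is a transformation of a `₂φ₁` into a very-well-poised `₈φ₇`
(`psiTransformation_inv`). Shifting the summation index by one exchanges the parameters `(a, β, γ)`
and `(a/q², qβ, qγ)` (`PsiTransformation.of_shift`), so the case `1/a` yields every `β = q^N/a`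
(`psiTransformation_pow_div`), and these points accumulate at `0` (`psiTransformation`).

The unilateral identity `tsum_phiTerm_eq` is itself continued analytically, now in `x`, from the
points `x = q^m`. There the `₂φ₁` terms are expanded in well-poised functions of `γ`
(`sum_antidiagonal_expansionTerm`), the double sum is interchanged, and the inner sum terminates and
is evaluated by `sum_range_qChuVandermonde`.

What remains is to translate the entire normalization back into the quotients of shifted factorials
that define `psi`. -/

open Finset Filter Topology

/-! ### Homogeneous finite products and infinite products: bounds and analyticity. -/

/-- The homogeneous `q`-product `∏_{i < n} (y - x q^i)`. -/
def qProd (y x q : ℂ) (n : ℕ) : ℂ := ∏ i ∈ range n, (y - x * q ^ i)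

theorem qProd_zero (y x q : ℂ) : qProd y x q 0 = 1 := by simp [qProd]

theorem qProd_succ (y x q : ℂ) (n : ℕ) :
    qProd y x q (n + 1) = qProd y x q n * (y - x * q ^ n) := by
  simp [qProd, prod_range_succ]

theorem qProd_succ' (y x q : ℂ) (n : ℕ) :
    qProd y x q (n + 1) = (y - x) * qProd y (x * q) q n := by
  simp only [qProd, prod_range_succ', pow_zero, mul_one]
  rw [mul_comm]
  congr 1
  exact prod_congr rfl fun i _ => by ring

theorem qProd_add (y x q : ℂ) (m n : ℕ) :
    qProd y x q (m + n) = qProd y x q m * qProd y (x * q ^ m) q n := by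
  simp only [qProd, prod_range_add]
  congr 1
  exact prod_congr rfl fun i _ => by ring

theorem mul_qProd (c y x q : ℂ) (n : ℕ) :
    c ^ n * qProd y x q n = qProd (c * y) (c * x) q n := by
  induction n with
  | zero => simp [qProd]
  | succ n ih => rw [qProd_succ, qProd_succ, ← ih]; ring

theorem qProd_one_left_ne_zero {q : ℂ} (hq : ‖q‖ < 1) (n : ℕ) :
    qProd 1 q q n ≠ 0 := by
  refine prod_ne_zero_iff.mpr fun i _ h => ?_
  have h1 : ‖q ^ (i + 1)‖ = 1 := by
    rw [pow_succ', ← sub_eq_zero.mp h, norm_one]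
  rw [norm_pow] at h1
  exact absurd h1 (pow_lt_one₀ (norm_nonneg _) hq (Nat.succ_ne_zero i)).ne

theorem sum_mul_norm_pow_le {q : ℂ} (hq : ‖q‖ < 1) {t : ℝ} (ht : 0 ≤ t) (n : ℕ) :
    ∑ i ∈ range n, t * ‖q‖ ^ i ≤ t / (1 - ‖q‖) := by
  rw [← mul_sum, div_eq_mul_inv, ← tsum_geometric_of_lt_one (norm_nonneg q) hq]
  exact mul_le_mul_of_nonneg_left ((summable_geometric_of_lt_one (norm_nonneg q) hq).sum_le_tsum _
    fun i _ => by positivity) ht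

/-- Taking out `r` from each factor leaves a product bounded by the exponential of a geometric
series. The constant depends on `y` and `x` only through `r` and `X`, as the Weierstrass M-test
needs; `r` is a separate positive number so that `y = 0` is allowed. -/
theorem norm_qProd_le {q : ℂ} (hq : ‖q‖ < 1) {y x : ℂ} {r X : ℝ} (hr : 0 < r) (hy : ‖y‖ ≤ r)
    (hx : ‖x‖ ≤ X) (n : ℕ) :
    ‖qProd y x q n‖ ≤ Real.exp (X / r / (1 - ‖q‖)) * r ^ n := by
  have hX : 0 ≤ X := (norm_nonneg x).trans hx
  calc ‖qProd y x q n‖ = ∏ i ∈ range n, ‖y - x * q ^ i‖ := by rw [qProd, norm_prod]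
    _ ≤ ∏ i ∈ range n, ((1 + X / r * ‖q‖ ^ i) * r) := by
      refine prod_le_prod (fun i _ => norm_nonneg _) fun i _ => (norm_sub_le _ _).trans ?_
      rw [norm_mul, norm_pow]
      have : (1 + X / r * ‖q‖ ^ i) * r = r + X * ‖q‖ ^ i := by field_simp
      rw [this]
      gcongr
    _ = (∏ i ∈ range n, (1 + X / r * ‖q‖ ^ i)) * r ^ n := by
      rw [prod_mul_distrib, prod_const, card_range]
    _ ≤ _ := by
      gcongr
      refine (Real.prod_one_add_le_exp_sum _ fun i => by positivity).trans ?_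
      exact Real.exp_le_exp.mpr (sum_mul_norm_pow_le hq (by positivity) n)

theorem norm_qProd_one_le {q : ℂ} (hq : ‖q‖ < 1) {x : ℂ} {X : ℝ} (hx : ‖x‖ ≤ X) (n : ℕ) :
    ‖qProd 1 x q n‖ ≤ Real.exp (X / (1 - ‖q‖)) := by
  simpa using norm_qProd_le hq one_pos norm_one.le hx n

theorem differentiable_qProd {q : ℂ} {f g : ℂ → ℂ} (hf : Differentiable ℂ f)
    (hg : Differentiable ℂ g) (n : ℕ) : Differentiable ℂ fun z => qProd (f z) (g z) q n := by
  simp only [qProd]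
  exact Differentiable.fun_finsetProd fun i _ => hf.sub (hg.mul_const _)

theorem summable_norm_mul_pow {q : ℂ} (hq : ‖q‖ < 1) (y : ℂ) :
    Summable fun i : ℕ => ‖-(y * q ^ i)‖ := by
  simpa [norm_mul, norm_pow] using (summable_geometric_of_lt_one (norm_nonneg q) hq).mul_left ‖y‖

theorem multipliable_one_sub_mul_pow {q : ℂ} (hq : ‖q‖ < 1) (y : ℂ) :
    Multipliable fun i : ℕ => 1 - y * q ^ i := by
  simpa [sub_eq_add_neg] using multipliable_one_add_of_summable (summable_norm_mul_pow hq y)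

theorem tendsto_qProd_one {q : ℂ} (hq : ‖q‖ < 1) (y : ℂ) :
    Tendsto (qProd 1 y q) atTop (𝓝 (qPochInf y q)) :=
  (multipliable_one_sub_mul_pow hq y).hasProd.tendsto_prod_nat

theorem qPochInf_eq_qProd_mul {q : ℂ} (hq : ‖q‖ < 1) (y : ℂ) (n : ℕ) :
    qPochInf y q = qProd 1 y q n * qPochInf (y * q ^ n) q :=
  qPochInf_split y hq n

theorem qPochInf_eq_mul {q : ℂ} (hq : ‖q‖ < 1) (y : ℂ) :
    qPochInf y q = (1 - y) * qPochInf (y * q) q := by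
  simpa [qProd] using qPochInf_eq_qProd_mul hq y 1

theorem norm_qPochInf_le {q : ℂ} (hq : ‖q‖ < 1) {y : ℂ} {Y : ℝ} (hy : ‖y‖ ≤ Y) :
    ‖qPochInf y q‖ ≤ Real.exp (Y / (1 - ‖q‖)) :=
  le_of_tendsto (tendsto_qProd_one hq y).norm (Eventually.of_forall fun n => norm_qProd_one_le hq hy n)

theorem qPochInf_ne_zero {q : ℂ} (hq : ‖q‖ < 1) {y : ℂ} (hy : ∀ n : ℕ, y * q ^ n ≠ 1) :
    qPochInf y q ≠ 0 := by
  have := tprod_one_add_ne_zero_of_summable (f := fun i : ℕ => -(y * q ^ i))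
    (fun i h => hy i (by linear_combination -h)) (summable_norm_mul_pow hq y)
  simpa [qPochInf, sub_eq_add_neg] using this

theorem differentiable_qPochInf {q : ℂ} (hq : ‖q‖ < 1) : Differentiable ℂ fun y => qPochInf y q := by
  intro y
  have hU : IsOpen (Metric.ball (0 : ℂ) (‖y‖ + 1)) := Metric.isOpen_ball
  have hu : Summable fun i : ℕ => (‖y‖ + 1) * ‖q‖ ^ i :=
    (summable_geometric_of_lt_one (norm_nonneg q) hq).mul_left _
  have h := Summable.hasProdLocallyUniformlyOn_nat_one_add (f := fun (i : ℕ) (z : ℂ) => -(z * q ^ i)) hU hu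
    (Eventually.of_forall fun i z hz => by
      rw [norm_neg, norm_mul, norm_pow]
      gcongr
      exact (mem_ball_zero_iff.mp hz).le)
    (fun i => by fun_prop)
  have hp (n : ℕ) : Differentiable ℂ fun z : ℂ => ∏ i ∈ range n, (1 + -(z * q ^ i)) :=
    Differentiable.fun_finsetProd fun i _ => by fun_prop
  have hd := (h.tendstoLocallyUniformlyOn_finsetRange).differentiableOn
    (Eventually.of_forall fun n => (hp n).differentiableOn) hU
  have := hd.differentiableAt (hU.mem_nhds (x := y) (by simp))
  simpa [qPochInf, sub_eq_add_neg] using this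

theorem qPochInf_differentiable_comp {q : ℂ} (hq : ‖q‖ < 1) {f : ℂ → ℂ} (hf : Differentiable ℂ f) :
    Differentiable ℂ fun z => qPochInf (f z) q :=
  (differentiable_qPochInf hq).comp hf

/-! ### Two finite identities: `q`-Chu–Vandermonde and the well-poised expansion. -/

/-- The finite `q`-Chu–Vandermonde sum, in a form without denominators depending on `A`. -/
theorem sum_range_qChuVandermonde {q : ℂ} (hq : ‖q‖ < 1) (A y : ℂ) {m M : ℕ} (hm : m < M) :
    ∑ j ∈ range M, qProd 1 A q j / qProd 1 q q j * qProd (q ^ m) 1 q j * y ^ j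
        * qPochInf (A * y * q ^ j) q
      = qProd 1 y q m * qPochInf (A * y * q ^ m) q := by
  have hqq := qProd_one_left_ne_zero hq
  induction m generalizing y M with
  | zero =>
    obtain ⟨N, rfl⟩ := Nat.exists_eq_succ_of_ne_zero hm.ne'
    rw [sum_range_succ', sum_eq_zero]
    · simp [qProd_zero]
    · intro j _
      rw [qProd_succ' (q ^ 0)]
      simp
  | succ m ih =>
    obtain ⟨N, rfl⟩ := Nat.exists_eq_succ_of_ne_zero (Nat.ne_zero_of_lt hm)
    have hN : m < N := Nat.lt_of_succ_lt_succ hm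
    have hvan : qProd (q ^ m) 1 q N = 0 := by
      refine prod_eq_zero (mem_range.mpr hN) ?_
      simp
    set c : ℕ → ℂ := fun j => qProd 1 A q j / qProd 1 q q j * qProd (q ^ m) 1 q j * (q * y) ^ j
      with hc
    -- The `q`-Pascal rule `(q^(m+1) - 1) q^j = (q^m - q^j) q^(j+1) - (1 - q^(j+1)) q^j`; both
    -- resulting terms belong to the case `m` at the argument `q y`.
    have hstep (j : ℕ) : qProd 1 A q (j + 1) / qProd 1 q q (j + 1) * qProd (q ^ (m + 1)) 1 q (j + 1)
          * y ^ (j + 1) * qPochInf (A * y * q ^ (j + 1)) q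
        = c (j + 1) * qPochInf (A * y * q ^ (j + 1)) q
          - y * (1 - A * q ^ j) * c j * qPochInf (A * (q * y) * q ^ j) q := by
      have h1 : qProd (q ^ (m + 1)) 1 q (j + 1)
          = (q ^ (m + 1) - 1) * (q ^ j * qProd (q ^ m) 1 q j) := by
        rw [qProd_succ', mul_qProd, pow_succ' q m, one_mul, mul_one]
      have h2 : A * (q * y) * q ^ j = A * y * q ^ (j + 1) := by ring
      have h3 := hqq j
      have h4 := hqq (j + 1)
      have h5 : q * q ^ j = q ^ (j + 1) := by ring
      simp only [hc, h1, h2, qProd_succ 1 A, qProd_succ (q ^ m)]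
      rw [qProd_succ 1 q] at h4 ⊢
      have h6 := right_ne_zero_of_mul h4
      generalize qPochInf (A * y * q ^ (j + 1)) q = e
      simp only [pow_succ] at h6 ⊢
      simp only [mul_pow]
      generalize q ^ j = t at *
      have h7 : 1 - t * q ≠ 0 := by rwa [mul_comm]
      field_simp
      ring
    have hsplit (j : ℕ) : qPochInf (A * y * q ^ j) q
        = (1 - A * y * q ^ j) * qPochInf (A * (q * y) * q ^ j) q := by
      rw [qPochInf_eq_mul hq]
      congr 2
      ring
    have hsum : ∑ j ∈ range N, c (j + 1) * qPochInf (A * y * q ^ (j + 1)) q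
          + c 0 * qPochInf (A * y * q ^ 0) q
        = ∑ j ∈ range N, c j * qPochInf (A * y * q ^ j) q := by
      rw [← sum_range_succ' fun j => c j * qPochInf (A * y * q ^ j) q, sum_range_succ]
      simp [hc, hvan]
    have h0 : qProd 1 A q 0 / qProd 1 q q 0 * qProd (q ^ (m + 1)) 1 q 0 * y ^ 0 = c 0 := by
      simp [hc, qProd_zero]
    rw [Nat.succ_eq_add_one, sum_range_succ', h0]
    simp only [hstep]
    rw [sum_sub_distrib, sub_add_eq_add_sub, hsum, ← sum_sub_distrib]
    -- After reindexing, the coefficient of each `c j` is `(1 - A y q^j) - y (1 - A q^j) = 1 - y`.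
    calc _ = (1 - y) * ∑ j ∈ range N, c j * qPochInf (A * (q * y) * q ^ j) q := by
          rw [mul_sum]
          refine sum_congr rfl fun j _ => ?_
          rw [hsplit]
          ring
      _ = _ := by
          rw [ih (q * y) hN, qProd_succ', mul_assoc, mul_comm q y, pow_succ' q m]
          ring_nf

/-- The `(k, j)` term in the expansion of `(γ - 1) ⋯ (γ - q^(n-1)) / ((1 - a q γ) ⋯ (1 - a q^n γ))`,
`n = k + j`, in the functions `(γ - x) ⋯ (γ - x q^(k-1)) / ((1 - a q γ) ⋯ (1 - a q^k γ))`. -/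
noncomputable def expansionTerm (q a x γ : ℂ) (k j : ℕ) : ℂ :=
  qProd 1 q q (k + j) / (qProd 1 q q k * qProd 1 q q j) * qProd x 1 q j
    * qProd 1 (a * q ^ (k + j)) q k * (1 - a * x * q ^ (2 * k)) * qProd 1 (a * x) q k
    * qPochInf (a * x * q ^ (2 * k + j + 1)) q * (qProd γ x q k * qPochInf (a * q ^ (k + 1) * γ) q)

/-- By induction on `n`: the case `n` at `(a q², x/q, γ/q)`, multiplied by the missing linear factor
in `γ`, re-expands in the functions `U k` for the original parameters. -/
theorem sum_antidiagonal_expansionTerm {q : ℂ} (hq0 : q ≠ 0) (hq : ‖q‖ < 1) (a x γ : ℂ) (n : ℕ) :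
    ∑ p ∈ antidiagonal n, expansionTerm q a x γ p.1 p.2
      = qPochInf (a * x) q * qProd γ 1 q n * qPochInf (a * q ^ (n + 1) * γ) q := by
  have hqq := qProd_one_left_ne_zero hq
  have hq1 (n : ℕ) : 1 - q * q ^ n ≠ 0 := by
    have := hqq (n + 1)
    rw [qProd_succ] at this
    exact right_ne_zero_of_mul this
  induction n generalizing a x γ with
  | zero =>
    simp [expansionTerm, qProd_zero, qPochInf_eq_mul hq (a * x)]
  | succ n ih =>
    obtain ⟨x, rfl⟩ : ∃ x', x = q * x' := ⟨x / q, by field_simp⟩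
    obtain ⟨γ, rfl⟩ : ∃ γ', γ = q * γ' := ⟨γ / q, by field_simp⟩
    set U : ℕ → ℂ := fun k => qProd (q * γ) (q * x) q k * qPochInf (a * q ^ (k + 1) * (q * γ)) q
      with hU
    set B : ℕ → ℕ → ℂ := fun k j => qProd 1 q q (k + j) / (qProd 1 q q k * qProd 1 q q j)
      * qProd (q * x) q q j * qProd 1 (a * q ^ (k + j + 2)) q k * qProd 1 (a * (q * x)) q (k + 1)
      * qPochInf (a * (q * x) * q ^ (2 * k + j + 2)) q with hB
    set c : ℕ → ℕ → ℂ := fun k j => B k j * (q * x * q ^ k - 1) * U k with hc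
    set d : ℕ → ℕ → ℂ := fun k j => B k j * (1 - a * q ^ (k + 1)) * U (k + 1) with hd
    -- With `G = qγ`, `X = q x q^k` and `p = a q^(k+1)` this rests on `(G - 1)(1 - p X) = (X - 1)(1
    -- - p G) + (1 - p)(G - X)`: the factor `1 - p G` gives back `U k`, and `G - X` gives `U (k +
    -- 1)`.
    have hcd (k j : ℕ) : (1 - a * (q * x)) * q ^ (k + j) * (q * γ - 1)
        * expansionTerm q (a * q ^ 2) x γ k j = c k j + d k j := by
      have e1 : U k = (1 - a * q ^ (k + 1) * (q * γ)) * (q ^ k * qProd γ x q k)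
          * qPochInf (a * q ^ 2 * q ^ (k + 1) * γ) q := by
        simp only [hU]
        rw [mul_qProd, qPochInf_eq_mul hq]
        ring_nf
      have e2 : U (k + 1) = (q * γ - q * x * q ^ k) * (q ^ k * qProd γ x q k)
          * qPochInf (a * q ^ 2 * q ^ (k + 1) * γ) q := by
        simp only [hU]
        rw [qProd_succ, mul_qProd]
        ring_nf
      have e3 : qProd 1 (a * (q * x)) q (k + 1)
          = (1 - a * (q * x)) * qProd 1 (a * q ^ 2 * x) q k := by
        rw [qProd_succ']
        ring_nf
      have e4 : qProd (q * x) q q j = q ^ j * qProd x 1 q j := by rw [mul_qProd, mul_one]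
      have e5 : a * q ^ (k + j + 2) = a * q ^ 2 * q ^ (k + j) := by ring
      have e6 : a * (q * x) * q ^ (2 * k + j + 2) = a * q ^ 2 * x * q ^ (2 * k + j + 1) := by ring
      simp only [hc, hd, hB, expansionTerm]
      rw [e1, e2, e3, e4, e5, e6]
      ring
    have hzero_left (j : ℕ) : expansionTerm q a (q * x) (q * γ) 0 (j + 1) = c 0 j := by
      have h := hqq (j + 1)
      have h' := hqq j
      simp only [expansionTerm, hc, hB]
      rw [qProd_succ' (q * x)]
      simp only [zero_add, qProd_zero, mul_zero, pow_zero, mul_one, one_mul]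
      rw [div_self h, div_self h', qProd_succ 1 (a * (q * x)) q 0, qProd_zero]
      simp only [hU, qProd_zero]
      ring_nf
    have hzero_right (k : ℕ) : expansionTerm q a (q * x) (q * γ) (k + 1) 0 = d k 0 := by
      have h := hqq (k + 1)
      have h' := hqq k
      simp only [expansionTerm, hd, hB, hU]
      simp only [add_zero, qProd_zero, mul_one]
      rw [qProd_succ' 1 (a * q ^ (k + 1)), div_self h, div_self h',
        qPochInf_eq_mul hq (a * (q * x) * q ^ (2 * k + 2))]
      ring_nf
    -- `U (k + 1)` receives one contribution from the index `k + 1` through `c` and one from `k`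
    -- through `d`; the two boundary terms above receive only one.
    have hsucc (k j : ℕ) : expansionTerm q a (q * x) (q * γ) (k + 1) (j + 1)
        = c (k + 1) j + d k (j + 1) := by
      have h := hqq (k + 1)
      have h' := hqq k
      have e1 : k + 1 + (j + 1) = (k + j + 1) + 1 := by ring
      have e2 : k + 1 + j = k + j + 1 := by ring
      have e3 : k + (j + 1) = k + j + 1 := by ring
      have e4 : a * q ^ (k + j + 1 + 1) * q = a * q ^ (k + j + 1 + 2) := by ring
      have e5 : a * (q * x) * q ^ (2 * k + (j + 1) + 2) * q
          = a * (q * x) * q ^ (2 * (k + 1) + j + 2) := by ring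
      have e6 : 2 * (k + 1) + (j + 1) + 1 = 2 * (k + 1) + j + 2 := by ring
      simp only [expansionTerm, hc, hd, hB]
      rw [e1, e2, e3, e6, qProd_succ' 1 (a * q ^ (k + j + 1 + 1)), e4, qProd_succ' (q * x) 1,
        qProd_succ 1 (a * q ^ (k + j + 1 + 2)), qProd_succ 1 (a * (q * x)) q (k + 1),
        qPochInf_eq_mul hq (a * (q * x) * q ^ (2 * k + (j + 1) + 2)), e5,
        qProd_succ (q * x) q, qProd_succ 1 q q (k + j + 1), qProd_succ 1 q q k,
        qProd_succ 1 q q j, one_mul]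
      have h1 := hqq (k + j + 1)
      have h2 := hqq j
      have h3 := hq1 k
      have h4 := hq1 j
      generalize qPochInf (a * (q * x) * q ^ (2 * (k + 1) + j + 2)) q = E
      change _ * _ * _ * _ * _ * _ * U (k + 1) = _
      generalize U (k + 1) = V
      generalize qProd 1 q q (k + j + 1) = z at *
      generalize qProd 1 q q k = z' at *
      generalize qProd 1 q q j = z'' at *
      field_simp
      ring
    calc _ = ∑ p ∈ antidiagonal n, (c p.1 p.2 + d p.1 p.2) := by
          rw [sum_add_distrib]
          cases n with
          | zero =>
            rw [Nat.sum_antidiagonal_succ]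
            simp [hzero_left 0, hzero_right 0]
          | succ n =>
            rw [Nat.sum_antidiagonal_succ, Nat.sum_antidiagonal_succ', hzero_left, hzero_right,
              Nat.sum_antidiagonal_succ (f := fun p => c p.1 p.2),
              Nat.sum_antidiagonal_succ' (f := fun p => d p.1 p.2)]
            simp only [hsucc, sum_add_distrib]
            ring
      _ = (1 - a * (q * x)) * q ^ n * (q * γ - 1)
            * ∑ p ∈ antidiagonal n, expansionTerm q (a * q ^ 2) x γ p.1 p.2 := by
          rw [mul_sum]
          refine sum_congr rfl fun p hp => ?_
          rw [← hcd, mem_antidiagonal.mp hp]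
      _ = _ := by
          have e1 : a * q ^ 2 * x = a * (q * x) * q := by ring
          have e2 : a * q ^ 2 * q ^ (n + 1) * γ = a * q ^ (n + 1 + 1) * (q * γ) := by ring
          have e3 : qProd (q * γ) 1 q (n + 1) = (q * γ - 1) * (q ^ n * qProd γ 1 q n) := by
            rw [qProd_succ', mul_qProd, one_mul, mul_one]
          rw [ih, e1, e2, e3, qPochInf_eq_mul hq (a * (q * x))]
          ring

/-! ### The unilateral transformation of `₂φ₁` into `₈φ₇`. -/

theorem exists_norm_inv_qProd_one_le {q : ℂ} (hq : ‖q‖ < 1) :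
    ∃ K, ∀ n, ‖(qProd 1 q q n)⁻¹‖ ≤ K := by
  have h0 : qPochInf q q ≠ 0 := by
    refine qPochInf_ne_zero hq fun n h => qProd_one_left_ne_zero hq (n + 1) ?_
    rw [qProd_succ, h, sub_self, mul_zero]
  obtain ⟨K, hK⟩ := ((tendsto_qProd_one hq q).inv₀ h0).norm.bddAbove_range
  exact ⟨K, fun n => hK ⟨n, rfl⟩⟩

theorem norm_mul_pow_mul_le {q : ℂ} (hq : ‖q‖ < 1) (a b : ℂ) (n : ℕ) :
    ‖a * q ^ n * b‖ ≤ ‖a‖ * ‖b‖ := by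
  rw [norm_mul, norm_mul, norm_pow]
  have := pow_le_one₀ (n := n) (norm_nonneg q) hq.le
  calc ‖a‖ * ‖q‖ ^ n * ‖b‖ ≤ ‖a‖ * 1 * ‖b‖ := by gcongr
    _ = _ := by ring

/-- Provides slack in the strict convergence condition, so that one geometric majorant serves a
whole ball around the parameters. -/
theorem exists_pos_mul_add_mul_add_lt_one {K A B : ℝ} (h : K * A * B < 1) :
    ∃ ε > 0, K * (A + ε) * (B + ε) < 1 := by
  have hc : Continuous fun ε : ℝ => K * (A + ε) * (B + ε) := by fun_prop
  have h1 : ∀ᶠ ε in 𝓝[>] (0 : ℝ), K * (A + ε) * (B + ε) < 1 :=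
    (hc.continuousAt.mono_left nhdsWithin_le_nhds).eventually_lt_const (by simpa using h)
  obtain ⟨ε, h2, h3⟩ := (h1.and self_mem_nhdsWithin).exists
  exact ⟨ε, h3, h2⟩

/-- The terms of a `₂φ₁` series with numerator parameters `a, 1/γ`. -/
noncomputable def phiTerm (q a γ x : ℂ) (n : ℕ) : ℂ :=
  qProd 1 a q n * (qProd 1 q q n)⁻¹ * qProd γ 1 q n * qPochInf (a * q ^ (n + 1) * γ) q
    * (q * x) ^ n

/-- The terms of the very-well-poised `₈φ₇` series related to `phiTerm`. -/
noncomputable def wellPoisedTerm (q a γ x : ℂ) (k : ℕ) : ℂ :=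
  (1 - a * q ^ (2 * k) * x) * qProd 1 a q (2 * k) * qProd 1 (a * x) q k * (qProd 1 q q k)⁻¹
    * qPochInf (a * q ^ (2 * k + 1) * x ^ 2) q * qProd γ x q k
    * qPochInf (a * q ^ (k + 1) * γ) q * (q * x) ^ k

theorem exists_norm_phiTerm_le {q : ℂ} (hq : ‖q‖ < 1) (a γ : ℂ) {ρ r : ℝ} (hr : 0 < r)
    (hγ : ‖γ‖ ≤ r) :
    ∃ C, ∀ n x, ‖x‖ ≤ ρ → ‖phiTerm q a γ x n‖ ≤ C * (‖q‖ * ρ * r) ^ n := by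
  obtain ⟨K, hK⟩ := exists_norm_inv_qProd_one_le hq
  have hK0 : 0 ≤ K := (norm_nonneg _).trans (hK 0)
  refine ⟨Real.exp (‖a‖ / (1 - ‖q‖)) * K * Real.exp (1 / r / (1 - ‖q‖))
    * Real.exp (‖a‖ * ‖γ‖ / (1 - ‖q‖)), fun n x hx => ?_⟩
  have h1 := norm_qProd_one_le hq (le_refl ‖a‖) n
  have h2 := norm_qProd_le hq (x := 1) hr hγ norm_one.le n
  have h3 := norm_qPochInf_le hq (norm_mul_pow_mul_le hq a γ (n + 1))
  have h4 := hK n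
  rw [phiTerm, norm_mul, norm_mul, norm_mul, norm_mul, norm_pow, norm_mul q x]
  calc _ ≤ Real.exp (‖a‖ / (1 - ‖q‖)) * K * (Real.exp (1 / r / (1 - ‖q‖)) * r ^ n)
      * Real.exp (‖a‖ * ‖γ‖ / (1 - ‖q‖)) * (‖q‖ * ρ) ^ n := by gcongr
    _ = _ := by ring

theorem exists_norm_wellPoisedTerm_le {q : ℂ} (hq : ‖q‖ < 1) (a γ : ℂ) {ρ r : ℝ} (hr : 0 < r)
    (hρ : 0 ≤ ρ) (hγ : ‖γ‖ ≤ r) :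
    ∃ C, ∀ k x, ‖x‖ ≤ ρ → ‖wellPoisedTerm q a γ x k‖ ≤ C * (‖q‖ * ρ * r) ^ k := by
  obtain ⟨K, hK⟩ := exists_norm_inv_qProd_one_le hq
  have hK0 : 0 ≤ K := (norm_nonneg _).trans (hK 0)
  refine ⟨(1 + ‖a‖ * ρ) * Real.exp (‖a‖ / (1 - ‖q‖)) * Real.exp (‖a‖ * ρ / (1 - ‖q‖)) * K
    * Real.exp (‖a‖ * ρ ^ 2 / (1 - ‖q‖)) * Real.exp (ρ / r / (1 - ‖q‖))
    * Real.exp (‖a‖ * ‖γ‖ / (1 - ‖q‖)), fun k x hx => ?_⟩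
  have h0 : ‖1 - a * q ^ (2 * k) * x‖ ≤ 1 + ‖a‖ * ρ := by
    refine (norm_sub_le _ _).trans ?_
    rw [norm_one]
    gcongr
    exact (norm_mul_pow_mul_le hq a x _).trans (by gcongr)
  have h1 := norm_qProd_one_le hq (le_refl ‖a‖) (2 * k)
  have h2 := norm_qProd_one_le hq (x := a * x) (X := ‖a‖ * ρ) (by rw [norm_mul]; gcongr) k
  have h3 := hK k
  have h4 := norm_qPochInf_le hq (y := a * q ^ (2 * k + 1) * x ^ 2) (Y := ‖a‖ * ρ ^ 2)
    ((norm_mul_pow_mul_le hq a _ _).trans (by rw [norm_pow]; gcongr))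
  have h5 := norm_qProd_le hq hr hγ hx k
  have h6 := norm_qPochInf_le hq (norm_mul_pow_mul_le hq a γ (k + 1))
  rw [wellPoisedTerm, norm_mul, norm_mul, norm_mul, norm_mul, norm_mul, norm_mul, norm_mul,
    norm_pow, norm_mul q x]
  calc _ ≤ (1 + ‖a‖ * ρ) * Real.exp (‖a‖ / (1 - ‖q‖)) * Real.exp (‖a‖ * ρ / (1 - ‖q‖)) * K
      * Real.exp (‖a‖ * ρ ^ 2 / (1 - ‖q‖)) * (Real.exp (ρ / r / (1 - ‖q‖)) * r ^ k)
      * Real.exp (‖a‖ * ‖γ‖ / (1 - ‖q‖)) * (‖q‖ * ρ) ^ k := by gcongr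
    _ = _ := by ring

theorem sum_antidiagonal_mul_expansionTerm {q : ℂ} (hq0 : q ≠ 0) (hq : ‖q‖ < 1) (a x γ : ℂ)
    (n : ℕ) :
    ∑ p ∈ antidiagonal n, qProd 1 a q (p.1 + p.2) * (qProd 1 q q (p.1 + p.2))⁻¹
        * (q * x) ^ (p.1 + p.2) * expansionTerm q a x γ p.1 p.2
      = qPochInf (a * x) q * phiTerm q a γ x n := by
  rw [phiTerm, show ∀ u v w s t y : ℂ, u * (v * w * s * t * y) = v * w * y * (u * s * t) from
    fun u v w s t y => by ring, ← sum_antidiagonal_expansionTerm hq0 hq, mul_sum]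
  exact sum_congr rfl fun p hp => by rw [mem_antidiagonal.mp hp]

/-- For fixed `k` the dependence on `j` is isolated in the last factor, which for `x = q^m` is the
`q`-Chu–Vandermonde summand with `A = a q^(2k)` and `y = q x`. -/
theorem mul_expansionTerm_eq {q : ℂ} (hq : ‖q‖ < 1) (a x γ : ℂ) (k j : ℕ) :
    qProd 1 a q (k + j) * (qProd 1 q q (k + j))⁻¹ * (q * x) ^ (k + j) * expansionTerm q a x γ k j
      = (1 - a * q ^ (2 * k) * x) * qProd 1 a q (2 * k) * qProd 1 (a * x) q k * (qProd 1 q q k)⁻¹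
        * qProd γ x q k * qPochInf (a * q ^ (k + 1) * γ) q * (q * x) ^ k
        * (qProd 1 (a * q ^ (2 * k)) q j / qProd 1 q q j * qProd x 1 q j * (q * x) ^ j
          * qPochInf (a * q ^ (2 * k) * (q * x) * q ^ j) q) := by
  have h := qProd_one_left_ne_zero hq (k + j)
  have e1 : qProd 1 a q (k + j) * qProd 1 (a * q ^ (k + j)) q k
      = qProd 1 a q (2 * k) * qProd 1 (a * q ^ (2 * k)) q j := by
    rw [← qProd_add, ← qProd_add]
    congr 1
    ring
  have e2 : a * x * q ^ (2 * k + j + 1) = a * q ^ (2 * k) * (q * x) * q ^ j := by ring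
  rw [expansionTerm, e2]
  calc _ = (qProd 1 a q (k + j) * qProd 1 (a * q ^ (k + j)) q k)
        * ((qProd 1 q q (k + j))⁻¹ * qProd 1 q q (k + j)) * (q * x) ^ (k + j)
        * ((qProd 1 q q k)⁻¹ * (qProd 1 q q j)⁻¹ * qProd x 1 q j
          * (1 - a * x * q ^ (2 * k)) * qProd 1 (a * x) q k
          * qPochInf (a * q ^ (2 * k) * (q * x) * q ^ j) q
          * (qProd γ x q k * qPochInf (a * q ^ (k + 1) * γ) q)) := by
        rw [div_eq_mul_inv, mul_inv]; ring
    _ = _ := by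
        rw [e1, inv_mul_cancel₀ h, pow_add]
        ring

/-- One absolutely convergent double series is summed in two ways: antidiagonals give the `₂φ₁`
terms, rows give the well-poised terms. -/
theorem tsum_phiTerm_eq_of_eq_pow {q : ℂ} (hq0 : q ≠ 0) (hq : ‖q‖ < 1) (a γ : ℂ) {x : ℂ} {m : ℕ}
    (hx : x = q ^ m) (hγ : ‖q * x * γ‖ < 1) :
    qPochInf (a * x) q * qPochInf (q * x ^ 2) q * ∑' n, phiTerm q a γ x n
      = qPochInf (q * x) q * ∑' k, wellPoisedTerm q a γ x k := by
  set f : ℕ × ℕ → ℂ := fun p => qProd 1 a q (p.1 + p.2) * (qProd 1 q q (p.1 + p.2))⁻¹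
    * (q * x) ^ (p.1 + p.2) * expansionTerm q a x γ p.1 p.2 with hf
  have hx1 : ‖x‖ ≤ 1 := by rw [hx, norm_pow]; exact pow_le_one₀ (norm_nonneg _) hq.le
  have hvan (j : ℕ) (hj : m < j) : qProd x 1 q j = 0 := by
    refine prod_eq_zero (mem_range.mpr hj) ?_
    simp [hx]
  have hsum : Summable f := by
    obtain ⟨K, hK⟩ := exists_norm_inv_qProd_one_le hq
    have hK0 : 0 ≤ K := (norm_nonneg _).trans (hK 0)
    obtain ⟨ε, hε, hlt⟩ := exists_pos_mul_add_mul_add_lt_one (K := ‖q‖) (A := ‖x‖) (B := ‖γ‖)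
      (by rwa [← norm_mul, ← norm_mul])
    have hr : 0 < ‖γ‖ + ε := by positivity
    have hγr : ‖γ‖ ≤ ‖γ‖ + ε := by linarith
    set κ := ‖q‖ * ‖x‖ * (‖γ‖ + ε) with hκ
    have hκ0 : 0 ≤ κ := by positivity
    have hκ1 : κ < 1 := by
      refine lt_of_le_of_lt ?_ hlt
      rw [hκ]
      gcongr
      linarith
    set C := (1 + ‖a‖) * Real.exp (‖a‖ / (1 - ‖q‖)) * Real.exp (‖a‖ / (1 - ‖q‖)) * K
      * Real.exp (‖x‖ / (‖γ‖ + ε) / (1 - ‖q‖)) * Real.exp (‖a‖ * ‖γ‖ / (1 - ‖q‖)) with hC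
    set D := Real.exp (‖a‖ / (1 - ‖q‖)) * K * Real.exp (1 / (1 - ‖q‖))
      * Real.exp (‖a‖ / (1 - ‖q‖)) with hD
    have hs1 : Summable fun k : ℕ => C * κ ^ k := (summable_geometric_of_lt_one hκ0 hκ1).mul_left _
    -- Since `x = q^m` kills every `j > m`, a constant majorant suffices in this direction.
    have hs2 : Summable fun j : ℕ => if j ≤ m then D else 0 := by
      refine summable_of_ne_finset_zero (s := range (m + 1)) fun j hj => ?_
      rw [if_neg]
      simpa [Nat.lt_succ_iff] using hj
    refine Summable.of_norm_bounded (hs1.mul_of_nonneg hs2 (fun k => by positivity)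
      fun j => by dsimp only; split_ifs <;> positivity) ?_
    rintro ⟨k, j⟩
    simp only [hf]
    by_cases hj : j ≤ m
    swap
    · rw [mul_expansionTerm_eq hq, hvan j (not_le.mp hj)]
      simp [hj]
    rw [if_pos hj, mul_expansionTerm_eq hq, norm_mul]
    have hqp (n : ℕ) : ‖q ^ n‖ ≤ 1 := by
      rw [norm_pow]; exact pow_le_one₀ (norm_nonneg _) hq.le
    refine mul_le_mul ?_ ?_ (norm_nonneg _) (by positivity)
    · have h0 : ‖1 - a * q ^ (2 * k) * x‖ ≤ 1 + ‖a‖ := by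
        refine (norm_sub_le _ _).trans ?_
        rw [norm_one]
        gcongr
        exact (norm_mul_pow_mul_le hq a x _).trans (mul_le_of_le_one_right (norm_nonneg a) hx1)
      have h1 := norm_qProd_one_le hq (le_refl ‖a‖) (2 * k)
      have h2 := norm_qProd_one_le hq (x := a * x) (X := ‖a‖)
        (by rw [norm_mul]; exact mul_le_of_le_one_right (norm_nonneg a) hx1) k
      have h3 := hK k
      have h5 := norm_qProd_le hq hr hγr (le_refl ‖x‖) k
      have h6 := norm_qPochInf_le hq (norm_mul_pow_mul_le hq a γ (k + 1))
      rw [norm_mul, norm_mul, norm_mul, norm_mul, norm_mul, norm_mul, norm_pow, norm_mul q x]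
      calc _ ≤ (1 + ‖a‖) * Real.exp (‖a‖ / (1 - ‖q‖)) * Real.exp (‖a‖ / (1 - ‖q‖)) * K
          * (Real.exp (‖x‖ / (‖γ‖ + ε) / (1 - ‖q‖)) * (‖γ‖ + ε) ^ k)
          * Real.exp (‖a‖ * ‖γ‖ / (1 - ‖q‖)) * (‖q‖ * ‖x‖) ^ k := by gcongr
        _ = _ := by simp only [hC, hκ, mul_pow]; ring
    · have h1 := norm_qProd_one_le hq (x := a * q ^ (2 * k)) (X := ‖a‖)
        (by rw [norm_mul]; exact mul_le_of_le_one_right (norm_nonneg a) (hqp _)) j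
      have h2 := hK j
      have h3 := norm_qProd_le hq one_pos hx1 (norm_one (α := ℂ)).le j
      rw [one_pow, mul_one, div_one] at h3
      have h4 : ‖q * x‖ ^ j ≤ 1 := by
        refine pow_le_one₀ (norm_nonneg _) ?_
        rw [norm_mul]
        exact mul_le_one₀ hq.le (norm_nonneg _) hx1
      have h5 := norm_qPochInf_le hq (y := a * q ^ (2 * k) * (q * x) * q ^ j) (Y := ‖a‖) (by
        rw [show a * q ^ (2 * k) * (q * x) * q ^ j = a * q ^ (2 * k + j + 1) * x by ring]
        exact (norm_mul_pow_mul_le hq a x _).trans (mul_le_of_le_one_right (norm_nonneg a) hx1))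
      rw [div_eq_mul_inv, norm_mul, norm_mul, norm_mul, norm_mul, norm_pow]
      calc _ ≤ Real.exp (‖a‖ / (1 - ‖q‖)) * K * Real.exp (1 / (1 - ‖q‖)) * 1
          * Real.exp (‖a‖ / (1 - ‖q‖)) := by gcongr
        _ = _ := by rw [hD]; ring
  have hrow (k : ℕ) : qPochInf (q * x ^ 2) q * ∑' j, f (k, j)
      = qPochInf (q * x) q * wellPoisedTerm q a γ x k := by
    rw [tsum_eq_sum (s := range (m + 1)) fun j hj => by
      simp only [hf]
      rw [mul_expansionTerm_eq hq, hvan j (by simpa [Nat.lt_succ_iff] using hj)]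
      simp]
    simp only [hf, mul_expansionTerm_eq hq]
    have hV := sum_range_qChuVandermonde hq (a * q ^ (2 * k)) (q * x) (Nat.lt_succ_self m)
    rw [← mul_sum]
    rw [← hx] at hV
    -- `x = q^m` is used once more: `(qx; q)_m (q x²; q)_∞ = (qx; q)_∞`.
    rw [hV, wellPoisedTerm, qPochInf_eq_qProd_mul hq (q * x) m, ← hx]
    ring_nf
  calc _ = qPochInf (q * x ^ 2) q * ∑' n, ∑ p ∈ antidiagonal n, f p := by
        simp only [hf, sum_antidiagonal_mul_expansionTerm hq0 hq, tsum_mul_left]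
        ring
    _ = qPochInf (q * x ^ 2) q * ∑' p, f p := by
        have h := (HasAntidiagonal.sigmaAntidiagonalEquivProd.summable_iff.mpr hsum).tsum_sigma'
          fun n => (hasSum_fintype _).summable
        rw [← HasAntidiagonal.sigmaAntidiagonalEquivProd.tsum_eq f]
        refine congrArg _ (Eq.trans ?_ h.symm)
        congr 1
        funext n
        rw [tsum_fintype]
        exact (sum_finset_coe f _).symm
    _ = _ := by
        rw [hsum.tsum_prod, ← tsum_mul_left, ← tsum_mul_left]
        exact tsum_congr hrow

/-- Both sides are analytic in `x` on a disc about `0` containing the given point, and they agree at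
`q^m` for all large `m`, a sequence tending to `0`. -/
theorem tsum_phiTerm_eq {q : ℂ} (hq0 : q ≠ 0) (hq : ‖q‖ < 1) (a γ x : ℂ) (hγ : ‖q * x * γ‖ < 1) :
    qPochInf (a * x) q * qPochInf (q * x ^ 2) q * ∑' n, phiTerm q a γ x n
      = qPochInf (q * x) q * ∑' k, wellPoisedTerm q a γ x k := by
  obtain ⟨ε, hε, hlt⟩ := exists_pos_mul_add_mul_add_lt_one (K := ‖q‖) (A := ‖x‖) (B := ‖γ‖)
    (by rwa [← norm_mul, ← norm_mul])
  set ρ := ‖x‖ + ε with hρ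
  have hρ0 : 0 < ρ := by positivity
  have hr : 0 < ‖γ‖ + ε := by positivity
  have hγr : ‖γ‖ ≤ ‖γ‖ + ε := by linarith
  have hκ := summable_geometric_of_lt_one (by positivity) hlt
  have hU : IsOpen (Metric.ball (0 : ℂ) ρ) := Metric.isOpen_ball
  obtain ⟨C, hC⟩ := exists_norm_phiTerm_le hq a γ (ρ := ρ) hr hγr
  obtain ⟨D, hD⟩ := exists_norm_wellPoisedTerm_le hq a γ hr hρ0.le hγr
  have hE {f : ℂ → ℂ} (hf : Differentiable ℂ f) : Differentiable ℂ fun z => qPochInf (f z) q :=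
    qPochInf_differentiable_comp hq hf
  have hl : DifferentiableOn ℂ (fun x => qPochInf (a * x) q * qPochInf (q * x ^ 2) q
      * ∑' n, phiTerm q a γ x n) (Metric.ball 0 ρ) := by
    refine DifferentiableOn.mul ((hE (by fun_prop)).mul (hE (by fun_prop))).differentiableOn ?_
    refine Complex.differentiableOn_tsum_of_summable_norm (hκ.mul_left C) (fun n => ?_) hU
      fun n z hz => hC n z (mem_ball_zero_iff.mp hz).le
    unfold phiTerm
    fun_prop
  have hr : DifferentiableOn ℂ (fun x => qPochInf (q * x) q * ∑' k, wellPoisedTerm q a γ x k)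
      (Metric.ball 0 ρ) := by
    refine DifferentiableOn.mul (hE (by fun_prop)).differentiableOn ?_
    refine Complex.differentiableOn_tsum_of_summable_norm (hκ.mul_left D) (fun n => ?_) hU
      fun n z hz => hD n z (mem_ball_zero_iff.mp hz).le
    unfold wellPoisedTerm
    have h1 : Differentiable ℂ fun z => qProd 1 (a * z) q n :=
      differentiable_qProd (by fun_prop) (by fun_prop) n
    have h2 : Differentiable ℂ fun z => qProd γ z q n :=
      differentiable_qProd (by fun_prop) (by fun_prop) n
    have h3 : Differentiable ℂ fun z => qPochInf (a * q ^ (2 * n + 1) * z ^ 2) q :=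
      hE (by fun_prop)
    refine Differentiable.differentiableOn ?_
    fun_prop
  have htend : Tendsto (fun m : ℕ => q ^ m) atTop (𝓝[≠] 0) :=
    tendsto_nhdsWithin_iff.mpr ⟨tendsto_pow_atTop_nhds_zero_of_norm_lt_one hq,
      Eventually.of_forall fun m => pow_ne_zero m hq0⟩
  have hcont : ∀ᶠ z : ℂ in 𝓝[≠] 0, ‖q * z * γ‖ < 1 := by
    have : Continuous fun z : ℂ => ‖q * z * γ‖ := by fun_prop
    exact (this.continuousAt.mono_left nhdsWithin_le_nhds).eventually_lt_const (by simp)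
  have hfreq : ∃ᶠ x : ℂ in 𝓝[≠] 0,
      qPochInf (a * x) q * qPochInf (q * x ^ 2) q * ∑' n, phiTerm q a γ x n
        = qPochInf (q * x) q * ∑' k, wellPoisedTerm q a γ x k := htend.frequently ((htend.eventually hcont).mono fun m hm =>
    tsum_phiTerm_eq_of_eq_pow hq0 hq a γ rfl hm).frequently
  exact (hl.analyticOnNhd hU).eqOn_of_preconnected_of_frequently_eq (hr.analyticOnNhd hU)
    (convex_ball 0 ρ).isPreconnected (Metric.mem_ball_self hρ0) hfreq
    (mem_ball_zero_iff.mpr (by rw [hρ]; linarith))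

/-! ### Bilateral factors normalized to be entire. -/

/-- `(1/y; q)_k y^k (q y; q)_∞`, extended to an entire function of `y` for every integer `k`. -/
noncomputable def qRev (q y : ℂ) (k : ℤ) : ℂ :=
  (-1) ^ k * q ^ (k * (k - 1) / 2) * qPochInf (q ^ (1 - k) * y) q

theorem triangle_succ (k : ℤ) : (k + 1) * (k + 1 - 1) / 2 = k * (k - 1) / 2 + k := by
  rw [show (k + 1) * (k + 1 - 1) = k * (k - 1) + k * 2 by ring,
    Int.add_mul_ediv_right _ _ two_ne_zero]

theorem triangle_neg (k : ℤ) : (-k) * (-k - 1) / 2 = k * (k - 1) / 2 + k := by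
  rw [show (-k) * (-k - 1) = k * (k - 1) + k * 2 by ring,
    Int.add_mul_ediv_right _ _ two_ne_zero]

theorem qRev_zero (q y : ℂ) : qRev q y 0 = qPochInf (q * y) q := by simp [qRev]

theorem qRev_succ {q : ℂ} (hq0 : q ≠ 0) (hq : ‖q‖ < 1) (y : ℂ) (k : ℤ) :
    qRev q y (k + 1) = (y - q ^ k) * qRev q y k := by
  have h1 : q ^ (1 - (k + 1)) * y = q ^ (-k) * y := by ring_nf
  have h2 : q ^ (-k) * y * q = q ^ (1 - k) * y := by
    rw [sub_eq_add_neg, zpow_add₀ hq0, zpow_one]; ring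
  have h3 : q ^ k ≠ 0 := zpow_ne_zero _ hq0
  rw [qRev, qRev, triangle_succ, zpow_add₀ hq0, h1, qPochInf_eq_mul hq (q ^ (-k) * y), h2,
    zpow_add₀ (by norm_num), zpow_neg]
  field_simp
  ring

theorem qRev_mul {q : ℂ} (hq0 : q ≠ 0) (y : ℂ) (k : ℤ) :
    qRev q (q * y) k = -q ^ (k - 1) * qRev q y (k - 1) := by
  have h1 : q ^ (1 - k) * (q * y) = q ^ (1 - (k - 1)) * y := by
    rw [show 1 - (k - 1) = (1 - k) + 1 by ring, zpow_add₀ hq0, zpow_one]; ring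
  have h2 := triangle_succ (k - 1)
  rw [sub_add_cancel] at h2
  rw [qRev, qRev, h1, h2, zpow_add₀ hq0, zpow_sub₀ (by norm_num : (-1 : ℂ) ≠ 0)]
  simp
  ring

theorem qRev_natCast {q : ℂ} (hq0 : q ≠ 0) (hq : ‖q‖ < 1) (y : ℂ) (n : ℕ) :
    qRev q y n = qProd y 1 q n * qPochInf (q * y) q := by
  induction n with
  | zero => simp [qRev_zero, qProd_zero]
  | succ n ih =>
    rw [Nat.cast_succ, qRev_succ hq0 hq, ih, qProd_succ, zpow_natCast]
    ring

/-- The `k`-th factor of a bilateral series contributed by a numerator parameter `1/y` and a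
denominator parameter `q z`, normalized to be entire in `y` and `z`. -/
noncomputable def bilFactor (q y z : ℂ) (k : ℤ) : ℂ := qRev q y k * qPochInf (q ^ (1 + k) * z) q

theorem bilFactor_natCast {q : ℂ} (hq0 : q ≠ 0) (hq : ‖q‖ < 1) (y z : ℂ) (n : ℕ) :
    bilFactor q y z n
      = qProd y 1 q n * qPochInf (q * y) q * qPochInf (q ^ (n + 1) * z) q := by
  rw [bilFactor, qRev_natCast hq0 hq, add_comm (1 : ℤ)]
  norm_cast

/-- The reflection `k ↦ -k` exchanges the roles of `y` and `z`, so estimates for negative indices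
reduce to those for positive ones. -/
theorem bilFactor_neg {q : ℂ} (hq0 : q ≠ 0) (hq : ‖q‖ < 1) (y z : ℂ) (n : ℕ) :
    bilFactor q y z (-n)
      = q ^ n * qProd z 1 q n * qPochInf (q * z) q * qPochInf (q ^ (n + 1) * y) q := by
  have h := qRev_natCast hq0 hq z n
  have h1 : q ^ (1 - -(n : ℤ)) = q ^ (n + 1) := by
    rw [sub_neg_eq_add, add_comm]
    norm_cast
  rw [mul_assoc (q ^ n), ← h, bilFactor, qRev, qRev, triangle_neg, zpow_add₀ hq0, h1, zpow_neg,
    zpow_natCast, zpow_natCast, ← inv_pow, ← sub_eq_add_neg]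
  norm_num
  ring

/-- The source of the index shift: moving `q` from `z` to `y` replaces `k` by `k - 1`, up to an
explicit power of `q`. -/
theorem bilFactor_mul_div {q : ℂ} (hq0 : q ≠ 0) (y z : ℂ) (k : ℤ) :
    bilFactor q (q * y) (z / q) k = -q ^ (k - 1) * bilFactor q y z (k - 1) := by
  have h : q ^ (1 + k) * (z / q) = q ^ (1 + (k - 1)) * z := by
    rw [show 1 + k = (1 + (k - 1)) + 1 by ring, zpow_add₀ hq0, zpow_one]
    field_simp
  rw [bilFactor, bilFactor, qRev_mul hq0, h]
  ring

/-! ### Two-sided geometric majorants. -/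

/-- The weight `u^k` for `k ≥ 0`, `v^(-k)` for `k ≤ 0`. -/
def twoSidedPow (u v : ℝ) (k : ℤ) : ℝ := u ^ k.toNat * v ^ (-k).toNat

theorem twoSidedPow_natCast (u v : ℝ) (n : ℕ) : twoSidedPow u v n = u ^ n := by
  simp [twoSidedPow]

theorem twoSidedPow_neg (u v : ℝ) (n : ℕ) : twoSidedPow u v (-n) = v ^ n := by
  simp [twoSidedPow]

theorem twoSidedPow_mul (u v u' v' : ℝ) (k : ℤ) :
    twoSidedPow u v k * twoSidedPow u' v' k = twoSidedPow (u * u') (v * v') k := by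
  simp only [twoSidedPow, mul_pow]
  ring

theorem twoSidedPow_nonneg {u v : ℝ} (hu : 0 ≤ u) (hv : 0 ≤ v) (k : ℤ) :
    0 ≤ twoSidedPow u v k := by
  unfold twoSidedPow
  positivity

theorem twoSidedPow_two_mul (u v : ℝ) (k : ℤ) :
    twoSidedPow u v (2 * k) = twoSidedPow (u ^ 2) (v ^ 2) k := by
  rw [twoSidedPow, twoSidedPow, ← pow_mul, ← pow_mul]
  congr 2 <;> omega

theorem summable_twoSidedPow {u v : ℝ} (hu : 0 ≤ u) (hv : 0 ≤ v) (hu1 : u < 1) (hv1 : v < 1) :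
    Summable (twoSidedPow u v) := by
  refine Summable.of_nat_of_neg ?_ ?_
  · simpa only [twoSidedPow_natCast] using summable_geometric_of_lt_one hu hu1
  · simpa only [twoSidedPow_neg] using summable_geometric_of_lt_one hv hv1

theorem norm_zpow_eq_twoSidedPow (c : ℂ) (k : ℤ) :
    ‖c ^ k‖ = twoSidedPow ‖c‖ ‖c‖⁻¹ k := by
  obtain ⟨n, rfl | rfl⟩ := k.eq_nat_or_neg
  · rw [twoSidedPow_natCast, zpow_natCast, norm_pow]
  · rw [twoSidedPow_neg, zpow_neg, zpow_natCast, norm_inv, norm_pow, inv_pow]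

theorem exists_norm_bilFactor_le {q : ℂ} (hq0 : q ≠ 0) (hq : ‖q‖ < 1) {r s : ℝ} (hr : 0 < r)
    (hs : 0 < s) :
    ∃ C, 0 ≤ C ∧ ∀ y z, ‖y‖ ≤ r → ‖z‖ ≤ s → ∀ k,
      ‖bilFactor q y z k‖ ≤ C * twoSidedPow r (‖q‖ * s) k := by
  set C₁ := Real.exp (1 / r / (1 - ‖q‖)) * Real.exp (r / (1 - ‖q‖)) * Real.exp (s / (1 - ‖q‖))
  set C₂ := Real.exp (1 / s / (1 - ‖q‖)) * Real.exp (s / (1 - ‖q‖)) * Real.exp (r / (1 - ‖q‖))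
  have hE {y : ℂ} {t : ℝ} (hy : ‖y‖ ≤ t) (n : ℕ) :
      ‖qPochInf (q ^ n * y) q‖ ≤ Real.exp (t / (1 - ‖q‖)) := by
    refine norm_qPochInf_le hq ?_
    rw [norm_mul, norm_pow]
    exact (mul_le_of_le_one_left (norm_nonneg y) (pow_le_one₀ (norm_nonneg q) hq.le)).trans hy
  refine ⟨C₁ + C₂, by positivity, fun y z hy hz k => ?_⟩
  obtain ⟨n, rfl | rfl⟩ := k.eq_nat_or_neg
  · have h1 := norm_qProd_le hq hr hy (norm_one (α := ℂ)).le n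
    have h2 := hE hy 1
    rw [pow_one] at h2
    rw [bilFactor_natCast hq0 hq, twoSidedPow_natCast, norm_mul, norm_mul]
    calc _ ≤ Real.exp (1 / r / (1 - ‖q‖)) * r ^ n * Real.exp (r / (1 - ‖q‖))
        * Real.exp (s / (1 - ‖q‖)) := by
          gcongr
          exact hE hz _
      _ = C₁ * r ^ n := by ring
      _ ≤ (C₁ + C₂) * r ^ n := by
          gcongr
          exact le_add_of_nonneg_right (by positivity)
  · have h1 := norm_qProd_le hq hs hz (norm_one (α := ℂ)).le n
    have h2 := hE hz 1
    rw [pow_one] at h2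
    rw [bilFactor_neg hq0 hq, twoSidedPow_neg, norm_mul, norm_mul, norm_mul, norm_pow]
    calc _ ≤ ‖q‖ ^ n * (Real.exp (1 / s / (1 - ‖q‖)) * s ^ n) * Real.exp (s / (1 - ‖q‖))
        * Real.exp (r / (1 - ‖q‖)) := by
          gcongr
          exact hE hy _
      _ = C₂ * (‖q‖ * s) ^ n := by rw [mul_pow]; ring
      _ ≤ (C₁ + C₂) * (‖q‖ * s) ^ n := by
          gcongr
          exact le_add_of_nonneg_left (by positivity)

/-- The terms of the bilateral series `₂ψ₂` with numerator parameters `1/β, 1/γ` and denominator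
parameters `a q β, a q γ`, normalized to be entire in `β` and `γ`. -/
noncomputable def psiTwoTerm (q a β γ x : ℂ) (k : ℤ) : ℂ :=
  bilFactor q β (a * β) k * bilFactor q γ (a * γ) k * (a * q * x) ^ k

/-- The terms of the very-well-poised `₈ψ₈` series with numerator parameters `x/β, x/γ` related to
`psiTwoTerm`, normalized to be entire in `β` and `γ`. -/
noncomputable def psiEightTerm (q a β γ x : ℂ) (k : ℤ) : ℂ :=
  (1 - a * x * q ^ (2 * k)) * bilFactor q a⁻¹ (a * x ^ 2) (2 * k) * bilFactor q (β / x) (a * β) k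
    * bilFactor q (γ / x) (a * γ) k * (a ^ 3 * q * x ^ 3) ^ k

/-- For `r = 1/|b|` and `s = 1/|c|` the forward and backward ratios are `|aqx/bc|` and `|aq/bcx|`,
the two quantities in the convergence condition. -/
theorem exists_norm_psiTwoTerm_le {q a x : ℂ} (hq0 : q ≠ 0) (hq : ‖q‖ < 1) (ha0 : a ≠ 0)
    (hx0 : x ≠ 0) {r s : ℝ} (hr : 0 < r) (hs : 0 < s) :
    ∃ C, ∀ β γ, ‖β‖ ≤ r → ‖γ‖ ≤ s → ∀ k,
      ‖psiTwoTerm q a β γ x k‖ ≤ C * twoSidedPow (‖a * q * x‖ * r * s) (‖a * q / x‖ * r * s) k := by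
  have ha : 0 < ‖a‖ := norm_pos_iff.mpr ha0
  have hx : 0 < ‖x‖ := norm_pos_iff.mpr hx0
  have hq' : 0 < ‖q‖ := norm_pos_iff.mpr hq0
  obtain ⟨C, hC0, hC⟩ := exists_norm_bilFactor_le hq0 hq hr (mul_pos ha hr)
  obtain ⟨D, hD0, hD⟩ := exists_norm_bilFactor_le hq0 hq hs (mul_pos ha hs)
  refine ⟨C * D, fun β γ hβ hγ k => ?_⟩
  have h1 := hC β (a * β) hβ (by rw [norm_mul]; gcongr) k
  have h2 := hD γ (a * γ) hγ (by rw [norm_mul]; gcongr) k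
  rw [psiTwoTerm, norm_mul, norm_mul, norm_zpow_eq_twoSidedPow]
  have h3 : 0 ≤ twoSidedPow ‖a * q * x‖ ‖a * q * x‖⁻¹ k :=
    twoSidedPow_nonneg (norm_nonneg _) (by positivity) k
  have h4 := (norm_nonneg _).trans h1
  calc _ ≤ (C * twoSidedPow r (‖q‖ * (‖a‖ * r)) k) * (D * twoSidedPow s (‖q‖ * (‖a‖ * s)) k)
        * twoSidedPow ‖a * q * x‖ ‖a * q * x‖⁻¹ k := by gcongr
    _ = C * D * (twoSidedPow r (‖q‖ * (‖a‖ * r)) k * twoSidedPow s (‖q‖ * (‖a‖ * s)) k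
        * twoSidedPow ‖a * q * x‖ ‖a * q * x‖⁻¹ k) := by ring
    _ = _ := by
      rw [twoSidedPow_mul, twoSidedPow_mul]
      simp only [norm_mul, norm_div]
      congr 2
      · ring
      · field_simp

/-- Here the ratio is the same in both directions, so on this side `|aqx/bc| < 1` alone ensures
convergence. -/
theorem exists_norm_psiEightTerm_le {q a x : ℂ} (hq0 : q ≠ 0) (hq : ‖q‖ < 1) (ha0 : a ≠ 0)
    (hx0 : x ≠ 0) {r s : ℝ} (hr : 0 < r) (hs : 0 < s) :
    ∃ C, ∀ β γ, ‖β‖ ≤ r → ‖γ‖ ≤ s → ∀ k,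
      ‖psiEightTerm q a β γ x k‖
        ≤ C * twoSidedPow (‖a * q * x‖ * r * s) (‖a * q * x‖ * r * s) k := by
  have ha : 0 < ‖a‖ := norm_pos_iff.mpr ha0
  have hx : 0 < ‖x‖ := norm_pos_iff.mpr hx0
  have hq' : 0 < ‖q‖ := norm_pos_iff.mpr hq0
  obtain ⟨C, hC0, hC⟩ := exists_norm_bilFactor_le hq0 hq (div_pos hr hx) (mul_pos ha hr)
  obtain ⟨D, hD0, hD⟩ := exists_norm_bilFactor_le hq0 hq (div_pos hs hx) (mul_pos ha hs)
  obtain ⟨B, hB0, hB⟩ := exists_norm_bilFactor_le hq0 hq (inv_pos.mpr ha)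
    (mul_pos ha (pow_pos hx 2))
  refine ⟨(1 + ‖a‖ * ‖x‖) * B * C * D, fun β γ hβ hγ k => ?_⟩
  have h1 := hC (β / x) (a * β) (by rw [norm_div]; gcongr) (by rw [norm_mul]; gcongr) k
  have h2 := hD (γ / x) (a * γ) (by rw [norm_div]; gcongr) (by rw [norm_mul]; gcongr) k
  have h3 := hB a⁻¹ (a * x ^ 2) (by rw [norm_inv]) (by rw [norm_mul, norm_pow]) (2 * k)
  rw [twoSidedPow_two_mul] at h3
  -- For `k < 0` this factor may grow like `|q|^(2k)`, which is the origin of the backward weight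
  -- `|q|⁻²`.
  have h0 : ‖1 - a * x * q ^ (2 * k)‖ ≤ (1 + ‖a‖ * ‖x‖) * twoSidedPow 1 (‖q‖⁻¹ ^ 2) k := by
    have hk : ‖q ^ (2 * k)‖ ≤ twoSidedPow 1 (‖q‖⁻¹ ^ 2) k ∧ 1 ≤ twoSidedPow 1 (‖q‖⁻¹ ^ 2) k := by
      rw [norm_zpow_eq_twoSidedPow, twoSidedPow_two_mul]
      obtain ⟨n, rfl | rfl⟩ := k.eq_nat_or_neg
      · simp only [twoSidedPow_natCast, one_pow, le_refl, and_true]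
        exact pow_le_one₀ (by positivity) (pow_le_one₀ hq'.le hq.le)
      · simp only [twoSidedPow_neg, le_refl, true_and]
        exact one_le_pow₀ (one_le_pow₀ ((one_le_inv₀ hq').mpr hq.le))
    refine (norm_sub_le _ _).trans ?_
    rw [norm_one, norm_mul, norm_mul, add_mul, one_mul]
    gcongr
    · exact hk.2
    · exact hk.1
  rw [psiEightTerm, norm_mul, norm_mul, norm_mul, norm_mul, norm_zpow_eq_twoSidedPow]
  have n1 := (norm_nonneg _).trans h1
  have n3 := (norm_nonneg _).trans h3
  have n0 := (norm_nonneg _).trans h0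
  have n4 : 0 ≤ twoSidedPow ‖a ^ 3 * q * x ^ 3‖ ‖a ^ 3 * q * x ^ 3‖⁻¹ k :=
    twoSidedPow_nonneg (norm_nonneg _) (by positivity) k
  calc _ ≤ ((1 + ‖a‖ * ‖x‖) * twoSidedPow 1 (‖q‖⁻¹ ^ 2) k)
        * (B * twoSidedPow (‖a‖⁻¹ ^ 2) ((‖q‖ * (‖a‖ * ‖x‖ ^ 2)) ^ 2) k)
        * (C * twoSidedPow (r / ‖x‖) (‖q‖ * (‖a‖ * r)) k)
        * (D * twoSidedPow (s / ‖x‖) (‖q‖ * (‖a‖ * s)) k)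
        * twoSidedPow ‖a ^ 3 * q * x ^ 3‖ ‖a ^ 3 * q * x ^ 3‖⁻¹ k := by gcongr
    _ = (1 + ‖a‖ * ‖x‖) * B * C * D * (twoSidedPow 1 (‖q‖⁻¹ ^ 2) k
        * twoSidedPow (‖a‖⁻¹ ^ 2) ((‖q‖ * (‖a‖ * ‖x‖ ^ 2)) ^ 2) k
        * twoSidedPow (r / ‖x‖) (‖q‖ * (‖a‖ * r)) k * twoSidedPow (s / ‖x‖) (‖q‖ * (‖a‖ * s)) k
        * twoSidedPow ‖a ^ 3 * q * x ^ 3‖ ‖a ^ 3 * q * x ^ 3‖⁻¹ k) := by ring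
    _ = _ := by
      rw [twoSidedPow_mul, twoSidedPow_mul, twoSidedPow_mul, twoSidedPow_mul]
      simp only [norm_mul, norm_pow]
      congr 2
      · field_simp
      · field_simp

/-! ### The bilateral transformation: special values of `β` and analytic continuation. -/

/-- The entire form of the transformation of a `₂ψ₂` series into a very-well-poised `₈ψ₈`
series. -/
def PsiTransformation (q a β γ x : ℂ) : Prop :=
  qPochInf (a * x) q * qPochInf (q / (a * x)) q * qPochInf (q * x ^ 2) q
      * qPochInf (a * q * β * γ / x) q * ∑' k, psiTwoTerm q a β γ x k
    = qPochInf (a * q * β * γ) q * qPochInf (q * x) q * ∑' k, psiEightTerm q a β γ x k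

theorem tsum_int_eq_tsum_nat {f : ℤ → ℂ} (hf : ∀ n : ℕ, f (-(n + 1 : ℕ)) = 0) :
    ∑' k, f k = ∑' n : ℕ, f n := by
  refine (Nat.cast_injective.tsum_eq (f := f) fun k hk => ?_).symm
  obtain ⟨n, rfl | rfl⟩ := k.eq_nat_or_neg
  · exact ⟨n, rfl⟩
  · cases n with
    | zero => exact ⟨0, by simp⟩
    | succ n => exact absurd (hf n) hk

/-- With `z = 1` the denominator parameter is `q`, and `1/(q; q)_k = 0` for `k < 0`; this makes the
bilateral series unilateral. -/
theorem bilFactor_one_right_neg {q : ℂ} (hq0 : q ≠ 0) (hq : ‖q‖ < 1) (y : ℂ) (n : ℕ) :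
    bilFactor q y 1 (-(n + 1 : ℕ)) = 0 := by
  rw [bilFactor_neg hq0 hq, qProd_succ']
  simp

theorem bilFactor_one_right_natCast {q : ℂ} (hq0 : q ≠ 0) (hq : ‖q‖ < 1) {y : ℂ} (hy : y ≠ 0)
    (n : ℕ) :
    bilFactor q y⁻¹ 1 n = (qProd 1 y q n * (qProd 1 q q n)⁻¹ * qPochInf (q / y) q * qPochInf q q)
      * (y ^ n)⁻¹ := by
  have h1 : y ^ n * qProd y⁻¹ 1 q n = qProd 1 y q n := by
    rw [mul_qProd, mul_inv_cancel₀ hy, mul_one]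
  have h2 : qProd 1 q q n * qPochInf (q ^ (n + 1) * 1) q = qPochInf q q := by
    rw [qPochInf_eq_qProd_mul hq q n, mul_one, pow_succ']
  have h3 := qProd_one_left_ne_zero hq n
  have h4 := pow_ne_zero n hy
  rw [bilFactor_natCast hq0 hq, ← h1, ← h2, ← div_eq_mul_inv q]
  field_simp

theorem psiTransformation_inv {q a x : ℂ} (hq0 : q ≠ 0) (hq : ‖q‖ < 1) (ha0 : a ≠ 0) (hx0 : x ≠ 0)
    {γ : ℂ} (hγ : ‖q * x * γ‖ < 1) : PsiTransformation q a a⁻¹ γ x := by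
  have hax : a⁻¹ / x = (a * x)⁻¹ := by rw [mul_inv]; rfl
  have hL : ∑' k, psiTwoTerm q a a⁻¹ γ x k
      = qPochInf (q / a) q * qPochInf q q * qPochInf (q * γ) q * ∑' n, phiTerm q a γ x n := by
    rw [tsum_int_eq_tsum_nat fun n => by
      rw [psiTwoTerm, mul_inv_cancel₀ ha0, bilFactor_one_right_neg hq0 hq]; simp, ← tsum_mul_left]
    refine tsum_congr fun n => ?_
    have e1 : q ^ (n + 1) * (a * γ) = a * q ^ (n + 1) * γ := by ring
    have e2 : (a * q * x) ^ n = a ^ n * (q * x) ^ n := by rw [← mul_pow]; ring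
    have h := pow_ne_zero n ha0
    rw [psiTwoTerm, mul_inv_cancel₀ ha0, bilFactor_one_right_natCast hq0 hq ha0,
      bilFactor_natCast hq0 hq, phiTerm, e1, zpow_natCast, e2]
    field_simp
  have hR : ∑' k, psiEightTerm q a a⁻¹ γ x k
      = qPochInf (q / a) q * qPochInf (q / (a * x)) q * qPochInf q q * qPochInf (q * γ / x) q
        * ∑' n, wellPoisedTerm q a γ x n := by
    rw [tsum_int_eq_tsum_nat fun n => by
      rw [psiEightTerm, mul_inv_cancel₀ ha0, bilFactor_one_right_neg hq0 hq]; simp, ← tsum_mul_left]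
    refine tsum_congr fun n => ?_
    have e1 : q ^ (n + 1) * (a * γ) = a * q ^ (n + 1) * γ := by ring
    have e2 : (a ^ 3 * q * x ^ 3) ^ n = a ^ (2 * n) * (a * x) ^ n * x ^ n * (q * x) ^ n := by
      rw [pow_mul, ← mul_pow, ← mul_pow, ← mul_pow]; ring
    have e3 : a ^ (2 * n) * qProd a⁻¹ 1 q (2 * n) = qProd 1 a q (2 * n) := by
      rw [mul_qProd, mul_inv_cancel₀ ha0, mul_one]
    have e4 : x ^ n * qProd (γ / x) 1 q n = qProd γ x q n := by
      rw [mul_qProd, mul_div_cancel₀ _ hx0, mul_one]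
    have e5 : ((2 : ℤ) * (n : ℤ)) = ((2 * n : ℕ) : ℤ) := by push_cast; rfl
    have e6 : q ^ (2 * n + 1) * (a * x ^ 2) = a * q ^ (2 * n + 1) * x ^ 2 := by ring
    have h := pow_ne_zero n (mul_ne_zero ha0 hx0)
    rw [psiEightTerm, mul_inv_cancel₀ ha0, hax, bilFactor_one_right_natCast hq0 hq
      (mul_ne_zero ha0 hx0), e5, bilFactor_natCast hq0 hq, bilFactor_natCast hq0 hq, e1, e6,
      wellPoisedTerm, ← e3, ← e4, zpow_natCast, zpow_natCast, e2, mul_div_assoc q γ x,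
      ← div_eq_mul_inv q a]
    rw [show a * x * q ^ (2 * n) = a * q ^ (2 * n) * x by ring]
    generalize (a * x) ^ n = t at *
    have ht : t * t⁻¹ = 1 := mul_inv_cancel₀ h
    generalize qPochInf q q = E₀
    generalize qPochInf (q / a) q = E₁
    generalize qPochInf (q / (a * x)) q = E₂
    generalize qPochInf (q * (γ / x)) q = E₃
    generalize qPochInf (a * q ^ (n + 1) * γ) q = E₄
    generalize qPochInf (a * q ^ (2 * n + 1) * x ^ 2) q = E₅
    linear_combination (1 - a * q ^ (2 * n) * x) * (qProd a⁻¹ 1 q (2 * n) * E₁ * E₅)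
      * (qProd 1 (a * x) q n * (qProd 1 q q n)⁻¹ * E₂ * E₀)
      * (qProd (γ / x) 1 q n * E₃ * E₄) * (a ^ (2 * n) * x ^ n * (q * x) ^ n) * ht
  have e1 : a * q * a⁻¹ * γ = q * γ := by field_simp
  rw [PsiTransformation, hL, hR, e1]
  linear_combination (qPochInf (q / (a * x)) q * qPochInf (q * γ / x) q * qPochInf (q / a) q
    * qPochInf q q * qPochInf (q * γ) q) * tsum_phiTerm_eq hq0 hq a γ x hγ

/-- Quasi-periodicity of the theta function `(y; q)_∞ (q/y; q)_∞`. It is applied twice to pass from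
`a x` to `a x / q²`. -/
theorem theta_div {q : ℂ} (hq0 : q ≠ 0) (hq : ‖q‖ < 1) {y : ℂ} (hy : y ≠ 0) :
    qPochInf (y / q) q * qPochInf (q / (y / q)) q
      = -(y / q) * (qPochInf y q * qPochInf (q / y) q) := by
  have h1 : y / q * q = y := by field_simp
  have h2 : q / (y / q) = q / y * q := by field_simp
  rw [h2, qPochInf_eq_mul hq (y / q), qPochInf_eq_mul hq (q / y), h1]
  field_simp
  ring

/-- Replacing `k` by `k - 1` in both series realizes the change of parameters, while `a β γ` and `x`
stay the same. -/
theorem PsiTransformation.of_shift {q a β γ x : ℂ} (hq0 : q ≠ 0) (hq : ‖q‖ < 1) (ha0 : a ≠ 0)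
    (hx0 : x ≠ 0) (h : PsiTransformation q (a / q ^ 2) (q * β) (q * γ) x) :
    PsiTransformation q a β γ x := by
  have hβ (y : ℂ) : a / q ^ 2 * (q * y) = a * y / q := by field_simp
  have hax : a * x ≠ 0 := mul_ne_zero ha0 hx0
  have hqk (k : ℤ) : q ^ k = q ^ (k - 1) * q := by
    rw [← zpow_add_one₀ hq0, sub_add_cancel]
  have hpow (n : ℕ) (k : ℤ) : (q ^ n) ^ k = (q ^ k) ^ n := by
    rw [← zpow_natCast, ← zpow_natCast, ← zpow_mul, ← zpow_mul, mul_comm]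
  have hL : ∑' k, psiTwoTerm q (a / q ^ 2) (q * β) (q * γ) x k
      = a * x / q * ∑' k, psiTwoTerm q a β γ x k := by
    rw [← (Equiv.subRight (1 : ℤ)).tsum_eq (psiTwoTerm q a β γ x), ← tsum_mul_left]
    refine tsum_congr fun k => ?_
    rw [Equiv.subRight_apply, psiTwoTerm, psiTwoTerm, hβ, hβ, bilFactor_mul_div hq0,
      bilFactor_mul_div hq0]
    have e : (a / q ^ 2 * q * x) ^ k
        = (q ^ (k - 1) * q ^ (k - 1))⁻¹ * (a * x / q) * (a * q * x) ^ (k - 1) := by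
      rw [show a / q ^ 2 * q * x = (a * q * x) * (q ^ 2)⁻¹ by field_simp, mul_zpow _ (q ^ 2)⁻¹,
        inv_zpow, hpow, hqk k, zpow_sub_one₀ (by positivity : a * q * x ≠ 0)]
      field_simp
    have hz := zpow_ne_zero (k - 1) hq0
    rw [e]
    field_simp
  have hR : ∑' k, psiEightTerm q (a / q ^ 2) (q * β) (q * γ) x k
      = (a * x) ^ 3 / q ^ 4 * ∑' k, psiEightTerm q a β γ x k := by
    rw [← (Equiv.subRight (1 : ℤ)).tsum_eq (psiEightTerm q a β γ x), ← tsum_mul_left]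
    refine tsum_congr fun k => ?_
    have e1 : (a / q ^ 2)⁻¹ = q * (q * a⁻¹) := by field_simp
    have e2 : a / q ^ 2 * x ^ 2 = a * x ^ 2 / q / q := by field_simp
    have e3 : 2 * k - 1 - 1 = 2 * (k - 1) := by ring
    have e4 : q ^ (2 * k - 1) = q ^ (k - 1) * q ^ (k - 1) * q := by
      rw [← zpow_add₀ hq0, ← zpow_add_one₀ hq0]; congr 1; ring
    have e5 : q ^ (2 * (k - 1)) = q ^ (k - 1) * q ^ (k - 1) := by
      rw [← zpow_add₀ hq0]; congr 1; ring
    have e6 : q ^ (2 * k) = q ^ (k - 1) * q ^ (k - 1) * q ^ 2 := by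
      rw [← zpow_add₀ hq0, ← zpow_natCast, ← zpow_add₀ hq0]; congr 1; push_cast; ring
    have hc : a ^ 3 * q * x ^ 3 ≠ 0 := by positivity
    have e7 : ((a / q ^ 2) ^ 3 * q * x ^ 3) ^ k = (a ^ 3 * q * x ^ 3) ^ (k - 1)
        * (a * x) ^ 3 / q ^ 5 * (q ^ (k - 1) * q ^ (k - 1) * q ^ (k - 1) * q ^ (k - 1)
          * q ^ (k - 1) * q ^ (k - 1))⁻¹ := by
      rw [show (a / q ^ 2) ^ 3 * q * x ^ 3 = (a ^ 3 * q * x ^ 3) * (q ^ 6)⁻¹ by field_simp,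
        mul_zpow _ (q ^ 6)⁻¹, inv_zpow, hpow, hqk k, zpow_sub_one₀ hc]
      field_simp
    have hz := zpow_ne_zero (k - 1) hq0
    rw [Equiv.subRight_apply, psiEightTerm, psiEightTerm, hβ, hβ, e1, e2, mul_div_assoc q β x,
      mul_div_assoc q γ x, bilFactor_mul_div hq0, bilFactor_mul_div hq0, bilFactor_mul_div hq0,
      bilFactor_mul_div hq0, e3, e7, e6, e4, e5]
    field_simp
  have e1 : a / q ^ 2 * x = a * x / q / q := by field_simp
  have e2 : a / q ^ 2 * q * (q * β) * (q * γ) = a * q * β * γ := by field_simp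
  rw [PsiTransformation, hL, hR, e1, e2, theta_div hq0 hq (div_ne_zero hax hq0),
    theta_div hq0 hq hax] at h
  -- The theta factor contributes `(a x)²/q³` and the shift of the `₂ψ₂` contributes `a x/q`; their
  -- product is the factor coming from the `₈ψ₈`.
  have hc : (a * x) ^ 3 / q ^ 4 ≠ 0 := div_ne_zero (pow_ne_zero 3 hax) (pow_ne_zero 4 hq0)
  refine mul_left_cancel₀ hc ?_
  linear_combination h

theorem psiTransformation_pow_div {q x : ℂ} (hq0 : q ≠ 0) (hq : ‖q‖ < 1) (hx0 : x ≠ 0) (N : ℕ) :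
    ∀ {a γ : ℂ}, a ≠ 0 → ‖q ^ (N + 1) * x * γ‖ < 1 → PsiTransformation q a (q ^ N / a) γ x := by
  induction N with
  | zero =>
    intro a γ ha0 hγ
    simpa using psiTransformation_inv hq0 hq ha0 hx0 (by simpa using hγ)
  | succ N ih =>
    intro a γ ha0 hγ
    refine .of_shift hq0 hq ha0 hx0 ?_
    have h := ih (a := a / q ^ 2) (γ := q * γ) (div_ne_zero ha0 (pow_ne_zero 2 hq0)) (by
      rwa [show q ^ (N + 1) * x * (q * γ) = q ^ (N + 1 + 1) * x * γ by ring])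
    rwa [show q ^ N / (a / q ^ 2) = q * (q ^ (N + 1) / a) by field_simp; ring] at h

theorem differentiable_bilFactor {q : ℂ} (hq : ‖q‖ < 1) {f g : ℂ → ℂ} (hf : Differentiable ℂ f)
    (hg : Differentiable ℂ g) (k : ℤ) : Differentiable ℂ fun z => bilFactor q (f z) (g z) k := by
  unfold bilFactor qRev
  exact ((qPochInf_differentiable_comp hq (hf.const_mul _)).const_mul _).mul
    (qPochInf_differentiable_comp hq (hg.const_mul _))

/-- Ismail's argument: both sides are analytic for `|β| < ρ`, and they agree at `β = q^N/a` for all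
large `N`. -/
theorem psiTransformation {q a β γ x : ℂ} (hq0 : q ≠ 0) (hq : ‖q‖ < 1) (ha0 : a ≠ 0) (hx0 : x ≠ 0)
    (h1 : ‖a * q * x * β * γ‖ < 1) (h2 : ‖a * q / x * β * γ‖ < 1) :
    PsiTransformation q a β γ x := by
  obtain ⟨ε, hε, hlt⟩ := exists_pos_mul_add_mul_add_lt_one (K := max ‖a * q * x‖ ‖a * q / x‖)
    (A := ‖β‖) (B := ‖γ‖) (by
      rw [mul_assoc, max_mul_of_nonneg _ _ (by positivity), ← mul_assoc, ← mul_assoc]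
      simpa only [← norm_mul] using max_lt h1 h2)
  set ρ := ‖β‖ + ε with hρ
  have hρ0 : 0 < ρ := by positivity
  have hr : 0 < ‖γ‖ + ε := by positivity
  have hγr : ‖γ‖ ≤ ‖γ‖ + ε := by linarith
  have hlt1 : ‖a * q * x‖ * ρ * (‖γ‖ + ε) < 1 :=
    lt_of_le_of_lt (by gcongr; exact le_max_left _ _) hlt
  have hlt2 : ‖a * q / x‖ * ρ * (‖γ‖ + ε) < 1 :=
    lt_of_le_of_lt (by gcongr; exact le_max_right _ _) hlt
  have hs1 := summable_twoSidedPow (by positivity) (by positivity) hlt1 hlt2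
  have hs2 := summable_twoSidedPow (by positivity) (by positivity) hlt1 hlt1
  have hU : IsOpen (Metric.ball (0 : ℂ) ρ) := Metric.isOpen_ball
  obtain ⟨C, hC⟩ := exists_norm_psiTwoTerm_le hq0 hq ha0 hx0 hρ0 hr
  obtain ⟨D, hD⟩ := exists_norm_psiEightTerm_le hq0 hq ha0 hx0 hρ0 hr
  have hE {f : ℂ → ℂ} (hf : Differentiable ℂ f) : Differentiable ℂ fun z => qPochInf (f z) q :=
    qPochInf_differentiable_comp hq hf
  have hl : DifferentiableOn ℂ (fun β => qPochInf (a * x) q * qPochInf (q / (a * x)) q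
      * qPochInf (q * x ^ 2) q * qPochInf (a * q * β * γ / x) q * ∑' k, psiTwoTerm q a β γ x k)
      (Metric.ball 0 ρ) := by
    refine DifferentiableOn.mul ((hE (by fun_prop)).const_mul _).differentiableOn ?_
    refine Complex.differentiableOn_tsum_of_summable_norm (hs1.mul_left C) (fun k => ?_) hU
      fun k z hz => hC z γ (mem_ball_zero_iff.mp hz).le hγr k
    unfold psiTwoTerm
    exact (((differentiable_bilFactor hq (by fun_prop) (by fun_prop) k).mul_const _).mul_const
      _).differentiableOn
  have hr : DifferentiableOn ℂ (fun β => qPochInf (a * q * β * γ) q * qPochInf (q * x) q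
      * ∑' k, psiEightTerm q a β γ x k) (Metric.ball 0 ρ) := by
    refine DifferentiableOn.mul ((hE (by fun_prop)).mul_const _).differentiableOn ?_
    refine Complex.differentiableOn_tsum_of_summable_norm (hs2.mul_left D) (fun k => ?_) hU
      fun k z hz => hD z γ (mem_ball_zero_iff.mp hz).le hγr k
    unfold psiEightTerm
    exact ((((differentiable_bilFactor hq (by fun_prop) (by fun_prop) k).const_mul _).mul_const
      _).mul_const _).differentiableOn
  have hpow := tendsto_pow_atTop_nhds_zero_of_norm_lt_one hq
  have htend : Tendsto (fun N : ℕ => q ^ N / a) atTop (𝓝[≠] 0) :=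
    tendsto_nhdsWithin_iff.mpr ⟨by simpa using hpow.div_const a,
      Eventually.of_forall fun N => div_ne_zero (pow_ne_zero N hq0) ha0⟩
  have hsmall : ∀ᶠ N : ℕ in atTop, ‖q ^ (N + 1) * x * γ‖ < 1 := by
    have := (((hpow.comp (tendsto_add_atTop_nat 1)).mul_const x).mul_const γ).norm
    exact this.eventually_lt_const (by simp)
  have hfreq : ∃ᶠ β : ℂ in 𝓝[≠] 0, PsiTransformation q a β γ x := htend.frequently
    (hsmall.mono fun N hN => psiTransformation_pow_div hq0 hq hx0 N ha0 hN).frequently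
  exact (hl.analyticOnNhd hU).eqOn_of_preconnected_of_frequently_eq (hr.analyticOnNhd hU)
    (convex_ball 0 ρ).isPreconnected (Metric.mem_ball_self hρ0) hfreq
    (mem_ball_zero_iff.mpr (by rw [hρ]; linarith))

/-! ### Shifted factorials of integer index and the return to the original terms. -/

theorem qPoch_zero (y q : ℂ) : qPoch y q 0 = 1 := by
  change qPoch y q (Int.ofNat 0) = 1
  simp [qPoch]

theorem qPoch_natCast_succ (y q : ℂ) (n : ℕ) :
    qPoch y q (n + 1 : ℕ) = (1 - y * q ^ n) * qPoch y q n := by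
  change ∏ i ∈ range (n + 1), _ = _ * ∏ i ∈ range n, _
  rw [prod_range_succ, mul_comm]

theorem qPoch_neg_natCast (y q : ℂ) (n : ℕ) :
    qPoch y q (-n) = (∏ i ∈ range n, (1 - y / q ^ (i + 1)))⁻¹ := by
  cases n with
  | zero => simp [qPoch_zero]
  | succ n => rfl

theorem qPoch_neg_natCast_succ (y q : ℂ) (n : ℕ) :
    qPoch y q (-(n + 1 : ℕ)) = (1 - y * q ^ (-(n + 1 : ℕ) : ℤ))⁻¹ * qPoch y q (-n) := by
  rw [qPoch_neg_natCast, qPoch_neg_natCast, prod_range_succ, mul_inv_rev, zpow_neg, zpow_natCast,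
    div_eq_mul_inv]

/-- For `k < 0` the factor `1 - y q^k` sits inside an inverse, so it must be nonzero to cancel. For
reciprocals, as in `inv_qPoch_eq`, the restriction falls on `k ≥ 0` instead. -/
theorem qPoch_succ {y q : ℂ} {k : ℤ} (h : k < 0 → 1 - y * q ^ k ≠ 0) :
    qPoch y q (k + 1) = (1 - y * q ^ k) * qPoch y q k := by
  obtain ⟨n, rfl | rfl⟩ := k.eq_nat_or_neg
  · exact_mod_cast qPoch_natCast_succ y q n
  · cases n with
    | zero => simpa using qPoch_natCast_succ y q 0
    | succ n =>
      have h1 := h (by lia)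
      rw [qPoch_neg_natCast_succ, mul_inv_cancel_left₀ h1]
      congr 1
      push_cast
      ring

theorem inv_qPoch_eq {y q : ℂ} {k : ℤ} (h : 0 ≤ k → 1 - y * q ^ k ≠ 0) :
    (qPoch y q k)⁻¹ = (1 - y * q ^ k) * (qPoch y q (k + 1))⁻¹ := by
  obtain hk | hk := lt_or_ge k 0
  · obtain ⟨n, rfl⟩ : ∃ n : ℕ, k = -(n + 1 : ℕ) := ⟨(-k - 1).toNat, by lia⟩
    rw [qPoch_neg_natCast_succ, mul_inv, inv_inv]
    congr 3
    push_cast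
    ring
  · rw [qPoch_succ fun h' => absurd h' (not_lt.mpr hk), mul_inv, mul_inv_cancel_left₀ (h hk)]

/-- The multiplier is divided out only when descending from `0`, hence its nonvanishing is needed
just for negative indices. This matches the excluded values of a numerator parameter; the backward
version serves denominators. -/
theorem eq_of_forward_recurrence {f g c : ℤ → ℂ} (h0 : f 0 = g 0)
    (hf : ∀ k, f (k + 1) = c k * f k) (hg : ∀ k, g (k + 1) = c k * g k)
    (hc : ∀ k < 0, c k ≠ 0) (k : ℤ) : f k = g k := by
  induction k using Int.induction_on with
  | zero => exact h0
  | succ n ih => rw [hf, hg, ih]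
  | pred n ih =>
    have hf' := hf (-n - 1)
    have hg' := hg (-n - 1)
    rw [sub_add_cancel] at hf' hg'
    exact mul_left_cancel₀ (hc (-n - 1) (by lia)) (by rw [← hf', ← hg', ih])

theorem eq_of_backward_recurrence {f g c : ℤ → ℂ} (h0 : f 0 = g 0)
    (hf : ∀ k, f k = c k * f (k + 1)) (hg : ∀ k, g k = c k * g (k + 1))
    (hc : ∀ k, 0 ≤ k → c k ≠ 0) (k : ℤ) : f k = g k := by
  induction k using Int.induction_on with
  | zero => exact h0
  | succ n ih =>
    exact mul_left_cancel₀ (hc n (by lia)) (by rw [← hf, ← hg, ih])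
  | pred n ih =>
    rw [hf, hg, sub_add_cancel, ih]

theorem one_sub_mul_zpow_ne_zero_of_neg {y q : ℂ} (hq0 : q ≠ 0) (hy : ∀ n : ℕ, y ≠ q ^ (n + 1))
    {k : ℤ} (hk : k < 0) : 1 - y * q ^ k ≠ 0 := by
  obtain ⟨n, rfl⟩ : ∃ n : ℕ, k = -(n + 1 : ℕ) := ⟨(-k - 1).toNat, by lia⟩
  intro h
  apply hy n
  rw [zpow_neg, zpow_natCast, sub_eq_zero, ← div_eq_mul_inv] at h
  exact ((eq_div_iff (pow_ne_zero _ hq0)).mp h).symm.trans (one_mul _)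

theorem one_sub_mul_zpow_ne_zero_of_nonneg {y q : ℂ} (hy : ∀ n : ℕ, y * q ^ n ≠ 1)
    {k : ℤ} (hk : 0 ≤ k) : 1 - y * q ^ k ≠ 0 := by
  lift k to ℕ using hk
  rw [zpow_natCast]
  exact fun h => hy k (sub_eq_zero.mp h).symm

theorem qPochInf_mul_qPoch {q y : ℂ} (hq0 : q ≠ 0) (hq : ‖q‖ < 1) (hy0 : y ≠ 0)
    (hy : ∀ n : ℕ, y ≠ q ^ (n + 1)) (k : ℤ) :
    qPochInf (q / y) q * qPoch y q k = qRev q y⁻¹ k * y ^ k := by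
  have hne (k : ℤ) (hk : k < 0) := one_sub_mul_zpow_ne_zero_of_neg hq0 hy hk
  refine eq_of_forward_recurrence (f := fun k => qPochInf (q / y) q * qPoch y q k)
    (g := fun k => qRev q y⁻¹ k * y ^ k) (c := fun k => 1 - y * q ^ k) ?_ (fun k => ?_) (fun k => ?_)
    hne k
  · simp [qPoch_zero, qRev_zero, div_eq_mul_inv]
  · rw [qPoch_succ (hne k)]
    ring
  · rw [qRev_succ hq0 hq, zpow_add_one₀ hy0]
    field_simp

theorem qPochInf_mul_inv_qPoch {q y : ℂ} (hq0 : q ≠ 0) (hq : ‖q‖ < 1) (hy : ∀ n : ℕ, y * q ^ n ≠ 1)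
    (k : ℤ) : qPochInf y q * (qPoch y q k)⁻¹ = qPochInf (q ^ k * y) q := by
  have hne (k : ℤ) (hk : 0 ≤ k) := one_sub_mul_zpow_ne_zero_of_nonneg hy hk
  refine eq_of_backward_recurrence (f := fun k => qPochInf y q * (qPoch y q k)⁻¹)
    (g := fun k => qPochInf (q ^ k * y) q) (c := fun k => 1 - y * q ^ k) ?_ (fun k => ?_)
    (fun k => ?_) hne k
  · simp [qPoch_zero]
  · rw [inv_qPoch_eq (hne k)]
    ring
  · rw [qPochInf_eq_mul hq, zpow_add_one₀ hq0]
    ring_nf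

theorem bilFactor_eq {q a b : ℂ} (hq0 : q ≠ 0) (hq : ‖q‖ < 1) {y z : ℂ} (hy0 : y ≠ 0)
    (hy : ∀ n : ℕ, y ≠ q ^ (n + 1)) (hz : ∀ n : ℕ, z * q ^ n ≠ 1) (k : ℤ) (ha : a = y⁻¹)
    (hb : z = q * b) :
    bilFactor q a b k
      = qPochInf (q / y) q * qPochInf z q * (qPoch y q k * (qPoch z q k)⁻¹) * (y ^ k)⁻¹ := by
  have h1 := qPochInf_mul_qPoch hq0 hq hy0 hy k
  have h2 := qPochInf_mul_inv_qPoch hq0 hq hz k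
  have h3 := zpow_ne_zero k hy0
  rw [bilFactor, ha, add_comm, zpow_add_one₀ hq0, mul_assoc (q ^ k), ← hb, ← h2,
    (eq_div_iff h3).mpr h1.symm]
  ring

theorem psiTerm_two_eq (b c d e q z : ℂ) (k : ℤ) :
    psiTerm [b, c] [d, e] q z k
      = qPoch b q k * (qPoch d q k)⁻¹ * (qPoch c q k * (qPoch e q k)⁻¹) * z ^ k := by
  simp only [psiTerm, qPochs, List.map_cons, List.map_nil, List.prod_cons, List.prod_nil,
    List.length_cons, List.length_nil, sub_self, zpow_zero, mul_one]
  ring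

theorem qPoch_mul_sub {q y : ℂ} (hq0 : q ≠ 0) (hy : ∀ n : ℤ, y ≠ q ^ n) (k : ℤ) :
    qPoch (q * y) q k * (1 - y) = qPoch y q k * (1 - y * q ^ k) := by
  have hne (k : ℤ) : 1 - y * q ^ k ≠ 0 := fun h => hy (-k) <| by
    rw [zpow_neg]
    exact eq_inv_of_mul_eq_one_left (sub_eq_zero.mp h).symm
  have hs (k : ℤ) : q * y * q ^ k = y * q ^ (k + 1) := by rw [zpow_add_one₀ hq0]; ring
  refine eq_of_forward_recurrence (f := fun k => qPoch (q * y) q k * (1 - y))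
    (g := fun k => qPoch y q k * (1 - y * q ^ k)) (c := fun k => 1 - y * q ^ (k + 1)) ?_
    (fun k => ?_) (fun k => ?_) (fun k _ => hne _) k
  · simp [qPoch_zero]
  · rw [qPoch_succ fun _ => by rw [hs]; exact hne _, hs]
    ring
  · rw [qPoch_succ fun _ => hne k]
    ring

theorem qPoch_mul_inv_qPoch {q y : ℂ} (hq0 : q ≠ 0) (hq : ‖q‖ < 1) (hy : ∀ n : ℤ, y ≠ q ^ n)
    (k : ℤ) : qPoch (q * y) q k * (qPoch y q k)⁻¹ * (1 - y) = 1 - y * q ^ k := by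
  have hn (n : ℕ) : y * q ^ n ≠ 1 := fun h => hy (-n) <| by
    rw [zpow_neg, zpow_natCast]
    exact eq_inv_of_mul_eq_one_left h
  have hk (n : ℕ) : q ^ k * y * q ^ n ≠ 1 := fun h => hy (-(k + n)) <| by
    rw [zpow_neg, zpow_add₀ hq0, zpow_natCast]
    exact eq_inv_of_mul_eq_one_left (by linear_combination h)
  have h1 : (qPoch y q k)⁻¹ ≠ 0 := fun h => qPochInf_ne_zero hq hk <| by
    rw [← qPochInf_mul_inv_qPoch hq0 hq hn, h, mul_zero]
  have h2 : qPoch y q k ≠ 0 := fun h => h1 (by rw [h, inv_zero])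
  rw [mul_right_comm, qPoch_mul_sub hq0 hy]
  field_simp

/-- The factors pair off as `(1 - w q^k)(1 + w q^k) = 1 - a q^(2k)`, and likewise for `±v` with odd
exponents, so four square-root parameters merge into one factorial of doubled index. -/
theorem qPoch_two_mul {q a v w : ℂ} (hq0 : q ≠ 0) (hv : v ^ 2 = a * q) (hw : w ^ 2 = a)
    (ha : ∀ n : ℕ, a ≠ q ^ (n + 1)) (k : ℤ) :
    qPoch v q k * qPoch (-v) q k * (qPoch w q k * qPoch (-w) q k) = qPoch a q (2 * k) := by
  have hne (k : ℤ) (hk : k < 0) := one_sub_mul_zpow_ne_zero_of_neg hq0 ha hk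
  have hsq (k : ℤ) : q ^ (2 * k) = q ^ k * q ^ k := by rw [two_mul, zpow_add₀ hq0]
  have ev (k : ℤ) : (1 - v * q ^ k) * (1 - -v * q ^ k) = 1 - a * q ^ (2 * k + 1) := by
    rw [zpow_add_one₀ hq0, hsq]
    linear_combination (-(q ^ k * q ^ k)) * hv
  have ew (k : ℤ) : (1 - w * q ^ k) * (1 - -w * q ^ k) = 1 - a * q ^ (2 * k) := by
    rw [hsq]
    linear_combination (-(q ^ k * q ^ k)) * hw
  refine eq_of_forward_recurrence
    (f := fun k => qPoch v q k * qPoch (-v) q k * (qPoch w q k * qPoch (-w) q k))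
    (g := fun k => qPoch a q (2 * k))
    (c := fun k => (1 - a * q ^ (2 * k + 1)) * (1 - a * q ^ (2 * k))) ?_
    (fun k => ?_) (fun k => ?_) (fun k hk => mul_ne_zero (hne _ (by lia)) (hne _ (by lia))) k
  · simp [qPoch_zero]
  · have h1 (hk : k < 0) := hne (2 * k + 1) (by lia)
    have h2 (hk : k < 0) := hne (2 * k) (by lia)
    rw [← ev] at h1 ⊢
    rw [← ew] at h2 ⊢
    rw [qPoch_succ fun hk => left_ne_zero_of_mul (h1 hk),
      qPoch_succ fun hk => right_ne_zero_of_mul (h1 hk),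
      qPoch_succ fun hk => left_ne_zero_of_mul (h2 hk),
      qPoch_succ fun hk => right_ne_zero_of_mul (h2 hk)]
    ring
  · rw [mul_add, mul_one, ← one_add_one_eq_two, ← add_assoc, one_add_one_eq_two,
      qPoch_succ fun h => hne _ h, qPoch_succ fun h => hne _ h, mul_assoc]

theorem inv_qPoch_two_mul {q a v w : ℂ} (hq0 : q ≠ 0) (hv : v ^ 2 = a) (hw : w ^ 2 = a * q)
    (ha : ∀ n : ℕ, a * q ^ n ≠ 1) (k : ℤ) :
    (qPoch v q k)⁻¹ * (qPoch (-v) q k)⁻¹ * ((qPoch w q k)⁻¹ * (qPoch (-w) q k)⁻¹)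
      = (qPoch a q (2 * k))⁻¹ := by
  have hne (k : ℤ) (hk : 0 ≤ k) := one_sub_mul_zpow_ne_zero_of_nonneg ha hk
  have hsq (k : ℤ) : q ^ (2 * k) = q ^ k * q ^ k := by rw [two_mul, zpow_add₀ hq0]
  have ev (k : ℤ) : (1 - v * q ^ k) * (1 - -v * q ^ k) = 1 - a * q ^ (2 * k) := by
    rw [hsq]
    linear_combination (-(q ^ k * q ^ k)) * hv
  have ew (k : ℤ) : (1 - w * q ^ k) * (1 - -w * q ^ k) = 1 - a * q ^ (2 * k + 1) := by
    rw [zpow_add_one₀ hq0, hsq]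
    linear_combination (-(q ^ k * q ^ k)) * hw
  refine eq_of_backward_recurrence
    (f := fun k => (qPoch v q k)⁻¹ * (qPoch (-v) q k)⁻¹ * ((qPoch w q k)⁻¹ * (qPoch (-w) q k)⁻¹))
    (g := fun k => (qPoch a q (2 * k))⁻¹)
    (c := fun k => (1 - a * q ^ (2 * k)) * (1 - a * q ^ (2 * k + 1))) ?_
    (fun k => ?_) (fun k => ?_) (fun k hk => mul_ne_zero (hne _ (by lia)) (hne _ (by lia))) k
  · simp [qPoch_zero]
  · have h1 (hk : 0 ≤ k) := hne (2 * k) (by lia)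
    have h2 (hk : 0 ≤ k) := hne (2 * k + 1) (by lia)
    rw [← ev] at h1 ⊢
    rw [← ew] at h2 ⊢
    rw [inv_qPoch_eq fun hk => left_ne_zero_of_mul (h1 hk),
      inv_qPoch_eq fun hk => right_ne_zero_of_mul (h1 hk),
      inv_qPoch_eq fun hk => left_ne_zero_of_mul (h2 hk),
      inv_qPoch_eq fun hk => right_ne_zero_of_mul (h2 hk)]
    ring
  · have e : 2 * (k + 1) = 2 * k + 1 + 1 := by ring
    rw [e, inv_qPoch_eq fun h => hne _ h, inv_qPoch_eq fun h => hne _ h, mul_assoc]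

theorem psiTerm_eight_eq (u v w b c u' v' w' d e q z : ℂ) (k : ℤ) :
    psiTerm [q * u, -(q * u), v, -v, w, -w, b, c] [u', -u', v', -v', w', -w', d, e] q z k
      = (qPoch (q * u) q k * (qPoch u' q k)⁻¹) * (qPoch (q * -u) q k * (qPoch (-u') q k)⁻¹)
        * ((qPoch v q k * qPoch (-v) q k * (qPoch w q k * qPoch (-w) q k))
          * ((qPoch v' q k)⁻¹ * (qPoch (-v') q k)⁻¹ * ((qPoch w' q k)⁻¹ * (qPoch (-w') q k)⁻¹)))
        * (qPoch b q k * (qPoch d q k)⁻¹) * (qPoch c q k * (qPoch e q k)⁻¹) * z ^ k := by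
  simp only [psiTerm, qPochs, List.map_cons, List.map_nil, List.prod_cons, List.prod_nil,
    List.length_cons, List.length_nil, sub_self, zpow_zero, mul_one, mul_neg]
  ring

/-! ### The theorem in its original parameters. -/

theorem theorem1 (q a b c x : ℂ)
    (hq0 : q ≠ 0) (hq1 : ‖q‖ < 1)
    (ha0 : a ≠ 0) (hb0 : b ≠ 0) (hc0 : c ≠ 0) (hx0 : x ≠ 0)
    -- the condition of convergence
    (hconv : max ‖a * q / (b * c * x)‖ ‖a * q * x / (b * c)‖ < 1)
    -- no zero factor occurs in a denominator
    (ha : ∀ n : ℕ, a ≠ q ^ (n + 1))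
    (hb : ∀ n : ℕ, b ≠ q ^ (n + 1))
    (hc : ∀ n : ℕ, c ≠ q ^ (n + 1))
    (hbx : ∀ n : ℕ, b * x ≠ q ^ (n + 1))
    (hcx : ∀ n : ℕ, c * x ≠ q ^ (n + 1))
    (hab : ∀ n : ℕ, a * q / b * q ^ n ≠ 1)
    (hac : ∀ n : ℕ, a * q / c * q ^ n ≠ 1)
    (hax : ∀ n : ℤ, a * x ≠ q ^ n)
    (hxx : ∀ n : ℕ, q * x ^ 2 * q ^ n ≠ 1)
    (haxx : ∀ n : ℕ, a * q * x ^ 2 * q ^ n ≠ 1)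
    -- any square roots of `a x`, `a q` and `a`
    (u v w : ℂ) (hu : u ^ 2 = a * x) (hv : v ^ 2 = a * q) (hw : w ^ 2 = a) :
    Summable (psiTerm [b, c] [a * q / b, a * q / c] q (a * q * x / (b * c))) ∧
    Summable (psiTerm
      [q * u, -(q * u), v, -v, w, -w, b * x, c * x]
      [u, -u, x * v, -(x * v), x * q * w, -(x * q * w), a * q / b, a * q / c]
      q (a * q * x / (b * c))) ∧
    psi [b, c] [a * q / b, a * q / c] q (a * q * x / (b * c)) =
      qPochInfs [q / a, a * q / (b * c), q / (b * x), q / (c * x), q * x, a * q * x ^ 2] q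
        / qPochInfs [q / b, q / c, a * q / (b * c * x), q / (a * x), a * q * x, q * x ^ 2] q
      * psi
          [q * u, -(q * u), v, -v, w, -w, b * x, c * x]
          [u, -u, x * v, -(x * v), x * q * w, -(x * q * w), a * q / b, a * q / c]
          q (a * q * x / (b * c)) := by
  have hbx0 := mul_ne_zero hb0 hx0
  have hcx0 := mul_ne_zero hc0 hx0
  have hax0 := mul_ne_zero ha0 hx0
  obtain ⟨hconv1, hconv2⟩ := max_lt_iff.mp hconv
  have hE {y : ℂ} (hy0 : y ≠ 0) (hy : ∀ n : ℕ, y ≠ q ^ (n + 1)) : qPochInf (q / y) q ≠ 0 :=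
    qPochInf_ne_zero hq1 fun n h => hy n <| by
      rw [div_mul_eq_mul_div, div_eq_one_iff_eq hy0] at h
      rw [← h, pow_succ']
  have hE1 := hE hb0 hb
  have hE2 := hE hc0 hc
  have hE3 := qPochInf_ne_zero hq1 hab
  have hE4 := qPochInf_ne_zero hq1 hac
  have hE5 := hE ha0 ha
  have hE6 := hE hbx0 hbx
  have hE7 := hE hcx0 hcx
  have hE8 := qPochInf_ne_zero hq1 haxx
  have hE9 := qPochInf_ne_zero hq1 hxx
  have hE10 := hE hax0 fun n => by exact_mod_cast hax (n + 1 : ℕ)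
  have hE11 : qPochInf (a * q * x) q ≠ 0 := qPochInf_ne_zero hq1 fun n h => hax (-(n + 1 : ℕ)) <| by
    rw [zpow_neg, zpow_natCast]
    exact eq_inv_of_mul_eq_one_left (by linear_combination h)
  have hE12 : qPochInf (a * q / (b * c * x)) q ≠ 0 := qPochInf_ne_zero hq1 fun n h => by
    have h1 := congrArg norm h
    rw [norm_mul, norm_pow, norm_one] at h1
    exact absurd h1 (mul_lt_one_of_nonneg_of_lt_one_left (norm_nonneg _) hconv1
      (pow_le_one₀ (norm_nonneg q) hq1.le)).ne
  have hax1 : 1 - a * x ≠ 0 := fun h => hax 0 (by rw [zpow_zero, sub_eq_zero.mp h])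
  -- A square root of `a x` equal to `q^n` would force `a x = q^(2n)`.
  have hun (s : ℂ) (hs : s ^ 2 = a * x) (n : ℤ) : s ≠ q ^ n := fun h => hax (2 * n) <| by
    rw [← hs, h, two_mul, zpow_add₀ hq0, sq]
  have htwo (k : ℤ) : psiTerm [b, c] [a * q / b, a * q / c] q (a * q * x / (b * c)) k
      = (qPochInf (q / b) q * qPochInf (q / c) q * qPochInf (a * q / b) q
        * qPochInf (a * q / c) q)⁻¹ * psiTwoTerm q a b⁻¹ c⁻¹ x k := by
    have hbk := zpow_ne_zero k hb0
    have hck := zpow_ne_zero k hc0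
    rw [psiTwoTerm, bilFactor_eq hq0 hq1 hb0 hb hab k rfl (by ring),
      bilFactor_eq hq0 hq1 hc0 hc hac k rfl (by ring), psiTerm_two_eq, div_zpow, mul_zpow b]
    generalize qPochInf (q / b) q = E₁ at *
    generalize qPochInf (q / c) q = E₂ at *
    generalize qPochInf (a * q / b) q = E₃ at *
    generalize qPochInf (a * q / c) q = E₄ at *
    field_simp
  have height (k : ℤ) : psiTerm
      [q * u, -(q * u), v, -v, w, -w, b * x, c * x]
      [u, -u, x * v, -(x * v), x * q * w, -(x * q * w), a * q / b, a * q / c]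
      q (a * q * x / (b * c)) k
      = ((1 - a * x) * qPochInf (q / a) q * qPochInf (a * q * x ^ 2) q * qPochInf (q / (b * x)) q
        * qPochInf (q / (c * x)) q * qPochInf (a * q / b) q * qPochInf (a * q / c) q)⁻¹
        * psiEightTerm q a b⁻¹ c⁻¹ x k := by
    have hak := zpow_ne_zero (2 * k) ha0
    have hbk := zpow_ne_zero k hbx0
    have hck := zpow_ne_zero k hcx0
    have hu1 := qPoch_mul_inv_qPoch hq0 hq1 (hun u hu) k
    have hu2 := qPoch_mul_inv_qPoch hq0 hq1 (hun (-u) (by rw [neg_sq, hu])) k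
    have hu12 : (qPoch (q * u) q k * (qPoch u q k)⁻¹) * (qPoch (q * -u) q k * (qPoch (-u) q k)⁻¹)
        = (1 - a * x)⁻¹ * (1 - a * x * q ^ (2 * k)) := by
      have h := congrArg₂ (· * ·) hu1 hu2
      rw [eq_inv_mul_iff_mul_eq₀ hax1, two_mul, zpow_add₀ hq0, ← hu]
      linear_combination h
    -- The normalized factors have absorbed `a^(2k)`, `(b x)^k` and `(c x)^k`; this restores the
    -- argument of the series.
    have ez : (a * q * x / (b * c)) ^ k
        = (a ^ (2 * k))⁻¹ * ((b * x) ^ k)⁻¹ * ((c * x) ^ k)⁻¹ * (a ^ 3 * q * x ^ 3) ^ k := by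
      rw [two_mul, zpow_add₀ ha0, mul_inv, ← inv_zpow, ← inv_zpow, ← inv_zpow, ← mul_zpow,
        ← mul_zpow, ← mul_zpow, ← mul_zpow]
      congr 1
      field_simp
    rw [psiEightTerm, bilFactor_eq (y := b * x) hq0 hq1 hbx0 hbx hab k (by field_simp) (by ring),
      bilFactor_eq (y := c * x) hq0 hq1 hcx0 hcx hac k (by field_simp) (by ring),
      bilFactor_eq hq0 hq1 ha0 ha haxx (2 * k) rfl (by ring), psiTerm_eight_eq, hu12,
      qPoch_two_mul hq0 hv hw ha,
      inv_qPoch_two_mul (a := a * q * x ^ 2) hq0 (by rw [mul_pow, hv]; ring)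
        (by rw [mul_pow, hw]; ring) haxx, ez]
    generalize qPochInf (q / a) q = E₁ at *
    generalize qPochInf (a * q * x ^ 2) q = E₂ at *
    generalize qPochInf (a * q / b) q = E₃ at *
    generalize qPochInf (a * q / c) q = E₄ at *
    generalize qPochInf (q / (b * x)) q = E₅ at *
    generalize qPochInf (q / (c * x)) q = E₆ at *
    generalize 1 - a * x = t at *
    field_simp
  have n1 : ‖a * q * x‖ * ‖b⁻¹‖ * ‖c⁻¹‖ < 1 := by
    rwa [← norm_mul, ← norm_mul,
      show a * q * x * b⁻¹ * c⁻¹ = a * q * x / (b * c) by field_simp]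
  have n2 : ‖a * q / x‖ * ‖b⁻¹‖ * ‖c⁻¹‖ < 1 := by
    rwa [← norm_mul, ← norm_mul,
      show a * q / x * b⁻¹ * c⁻¹ = a * q / (b * c * x) by field_simp]
  have hb' := norm_pos_iff.mpr (inv_ne_zero hb0)
  have hc' := norm_pos_iff.mpr (inv_ne_zero hc0)
  have hs1 : Summable (psiTwoTerm q a b⁻¹ c⁻¹ x) := by
    obtain ⟨C, hC⟩ := exists_norm_psiTwoTerm_le hq0 hq1 ha0 hx0 hb' hc'
    exact .of_norm_bounded ((summable_twoSidedPow (by positivity) (by positivity) n1 n2).mul_left C)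
      (hC b⁻¹ c⁻¹ le_rfl le_rfl)
  have hs2 : Summable (psiEightTerm q a b⁻¹ c⁻¹ x) := by
    obtain ⟨C, hC⟩ := exists_norm_psiEightTerm_le hq0 hq1 ha0 hx0 hb' hc'
    exact .of_norm_bounded ((summable_twoSidedPow (by positivity) (by positivity) n1 n1).mul_left C)
      (hC b⁻¹ c⁻¹ le_rfl le_rfl)
  refine ⟨(hs1.mul_left _).congr fun k => (htwo k).symm,
    (hs2.mul_left _).congr fun k => (height k).symm, ?_⟩
  have h := psiTransformation (β := b⁻¹) (γ := c⁻¹) hq0 hq1 ha0 hx0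
    (by rwa [norm_mul, norm_mul]) (by rwa [norm_mul, norm_mul])
  have e1 : a * q * b⁻¹ * c⁻¹ / x = a * q / (b * c * x) := by field_simp
  have e2 : a * q * b⁻¹ * c⁻¹ = a * q / (b * c) := by field_simp
  have e3 : a * x * q = a * q * x := by ring
  -- Splitting `(ax; q)_∞ = (1 - ax)(aqx; q)_∞` produces the factor `1 - ax` that cancels the one
  -- from the parameters `±q(ax)^(1/2)` over `±(ax)^(1/2)`.
  rw [PsiTransformation, e1, e2, qPochInf_eq_mul hq1 (a * x), e3] at h
  simp only [psi, htwo, height, tsum_mul_left, qPochInfs, List.map_cons, List.map_nil,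
    List.prod_cons, List.prod_nil, mul_one]
  generalize ∑' k, psiTwoTerm q a b⁻¹ c⁻¹ x k = S at *
  generalize ∑' k, psiEightTerm q a b⁻¹ c⁻¹ x k = T at *
  generalize qPochInf (q / a) q = E₁ at *
  generalize qPochInf (a * q * x ^ 2) q = E₂ at *
  generalize qPochInf (a * q / b) q = E₃ at *
  generalize qPochInf (a * q / c) q = E₄ at *
  generalize qPochInf (q / (b * x)) q = E₅ at *
  generalize qPochInf (q / (c * x)) q = E₆ at *
  generalize qPochInf (q / b) q = E₇ at *
  generalize qPochInf (q / c) q = E₈ at *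
  generalize qPochInf (a * q / (b * c * x)) q = E₉ at *
  generalize qPochInf (q / (a * x)) q = F₁ at *
  generalize qPochInf (a * q * x) q = F₂ at *
  generalize qPochInf (q * x ^ 2) q = F₃ at *
  generalize qPochInf (a * q / (b * c)) q = F₄ at *
  generalize qPochInf (q * x) q = F₅ at *
  generalize 1 - a * x = t at *
  field_simp
  linear_combination h
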